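/- Let $p$ be a prime, $X=\{x_1,\dots,x_d\}$ a finite set and $F(X)$ the free group on $X$. Let $\Lambda_p=\mathbb{F}_p\langle\langle u_1,\dots,u_d\rangle\rangle$ be the ring of formal power series in non-commuting variables over $\mathbb{F}_p$, let $I$ be its ideal generated by $u_1,\dots,u_d$, and let $\pi:F(X)\to\Lambda_p^{*}$ be the homomorphism with $\pi(x_i)=1+u_i$. Put $D_n=\{f\in F(X)\mid \pi(f)-1\in I^n\}$ and say that $f$ has degree $n\ge 1$ if $f\in D_n\setminus D_{n+1}$. For $R\subseteq F(X)$ let $n_i(R)$ be the number of elements of $R$ of degree $i$, and let $\hat d_R$ be the minimal number of topological generators of the pro-$p$ completion of the group $\langle X\mid R\rangle$. The presentation $\langle X\mid R\rangle$ is called Golod–Shafarevich (with respect to $p$) if all $n_i(R)$, $i\ge 1$, are finite and there is $t_0\in(0,1)$ such that $\sum_{i\ge 1}n_i(R)t_0^i$ converges and $$1-\hat d_R\,t_0+\sum_{i=1}^{\infty}n_i(R)\,t_0^i<0.$$ A set $R\subseteq F(X)$ is called a simple set of relations if (a) $R$ is computably enumerable, (b) the group $\langle X\mid R\rangle$ is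 infinite, and (c) every infinite computably enumerable set $B\subseteq F(X)$ contains two distinct elements $u\neq v$ with $uv^{-1}\in R$. **Theorem.** For every Golod–Shafarevich presentation $\langle X\mid S\rangle$ (where $S\subseteq F(X)$ is arbitrary, not necessarily computably enumerable) there exists a simple set of relations $R\subseteq F(X)$ such that the presentation $\langle X\mid S\cup R\rangle$ is again Golod–Shafarevich (with respect to the same prime $p$). -/

import Mathlib

/-- The ring `R⟨⟨σ⟩⟩` of formal power series in the non-commuting variables `σ` with coefficients in
`R`. A series is given by its coefficients: `f w` is the coefficient of the monomial (word) `w`. -/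
def NCPowerSeries (σ R : Type*) : Type _ := List σ → R

namespace NCPowerSeries

theorem ext {σ R : Type*} {f g : NCPowerSeries σ R} (h : ∀ w, f w = g w) : f = g := funext h

section Ring

variable {σ R : Type*} [Ring R]

noncomputable instance : AddCommGroup (NCPowerSeries σ R) :=
  inferInstanceAs (AddCommGroup (List σ → R))

/-- The Cauchy product: the coefficient of `w` in `f * g` is the sum of `f u * g v` over all
factorizations `w = u ++ v`. -/
noncomputable instance : Mul (NCPowerSeries σ R) :=
  ⟨fun f g w => ∑ i ∈ Finset.range (w.length + 1), f (w.take i) * g (w.drop i)⟩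

/-- The constant series `1`. -/
noncomputable instance : One (NCPowerSeries σ R) :=
  ⟨fun w => if w.length = 0 then 1 else 0⟩

theorem mul_apply (f g : NCPowerSeries σ R) (w : List σ) :
    (f * g) w = ∑ i ∈ Finset.range (w.length + 1), f (w.take i) * g (w.drop i) := rfl

theorem add_apply (f g : NCPowerSeries σ R) (w : List σ) : (f + g) w = f w + g w := rfl

theorem zero_apply (w : List σ) : (0 : NCPowerSeries σ R) w = 0 := rfl

theorem one_nil : (1 : NCPowerSeries σ R) [] = 1 := if_pos rfl

theorem one_cons (a : σ) (w : List σ) : (1 : NCPowerSeries σ R) (a :: w) = 0 :=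
  if_neg (by simp)

theorem mul_nil (f g : NCPowerSeries σ R) : (f * g) [] = f [] * g [] := by
  simp [mul_apply]

/-- The series `f'` with `f' w = f (a :: w)`. -/
def tail (a : σ) (f : NCPowerSeries σ R) : NCPowerSeries σ R := fun w => f (a :: w)

theorem mul_cons (f g : NCPowerSeries σ R) (a : σ) (w : List σ) :
    (f * g) (a :: w) = (tail a f * g) w + f [] * g (a :: w) := by
  rw [mul_apply, List.length_cons, Finset.sum_range_succ']
  rfl

protected theorem add_mul' (f g h : NCPowerSeries σ R) : (f + g) * h = f * h + g * h := by
  refine ext fun w => ?_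
  simp [add_apply, mul_apply, add_mul, Finset.sum_add_distrib]

protected theorem mul_add' (f g h : NCPowerSeries σ R) : f * (g + h) = f * g + f * h := by
  refine ext fun w => ?_
  simp [add_apply, mul_apply, mul_add, Finset.sum_add_distrib]

/-- Left multiplication of a series by a scalar. -/
def lscale (c : R) (f : NCPowerSeries σ R) : NCPowerSeries σ R := fun w => c * f w

theorem lscale_mul (c : R) (f g : NCPowerSeries σ R) (w : List σ) :
    (lscale c f * g) w = c * (f * g) w := by
  simp [mul_apply, lscale, Finset.mul_sum, mul_assoc]

theorem tail_mul (f g : NCPowerSeries σ R) (a : σ) :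
    tail a (f * g) = tail a f * g + lscale (f []) (tail a g) :=
  ext fun w => mul_cons f g a w

protected theorem mul_assoc' (f g h : NCPowerSeries σ R) : f * g * h = f * (g * h) := by
  refine ext fun w => ?_
  induction w generalizing f with
  | nil => simp [mul_nil, mul_assoc]
  | cons a w ih =>
    rw [mul_cons, mul_cons f, tail_mul, NCPowerSeries.add_mul', add_apply, ih, lscale_mul,
      mul_nil, mul_cons g, mul_add, mul_assoc, add_assoc]

protected theorem zero_mul' (f : NCPowerSeries σ R) : 0 * f = 0 :=
  ext fun w => by simp [mul_apply, zero_apply]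

protected theorem mul_zero' (f : NCPowerSeries σ R) : f * 0 = 0 :=
  ext fun w => by simp [mul_apply, zero_apply]

theorem tail_one (a : σ) : tail a (1 : NCPowerSeries σ R) = 0 := ext fun w => one_cons a w

protected theorem one_mul' (f : NCPowerSeries σ R) : 1 * f = f := by
  refine ext fun w => ?_
  cases w with
  | nil => simp [mul_nil, one_nil]
  | cons a w => simp [mul_cons, one_nil, tail_one, NCPowerSeries.zero_mul', zero_apply]

protected theorem mul_one' (f : NCPowerSeries σ R) : f * 1 = f := by
  refine ext fun w => ?_
  induction w generalizing f with
  | nil => simp [mul_nil, one_nil]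
  | cons a w ih => simp [mul_cons, one_cons, ih, tail]

noncomputable instance : Ring (NCPowerSeries σ R) :=
  { (inferInstance : AddCommGroup (NCPowerSeries σ R)) with
    mul := (· * ·)
    one := 1
    left_distrib := NCPowerSeries.mul_add'
    right_distrib := NCPowerSeries.add_mul'
    zero_mul := NCPowerSeries.zero_mul'
    mul_zero := NCPowerSeries.mul_zero'
    mul_assoc := NCPowerSeries.mul_assoc'
    one_mul := NCPowerSeries.one_mul'
    mul_one := NCPowerSeries.mul_one' }

end Ring

section Magnus

variable {σ : Type*} [DecidableEq σ] (R : Type*) [Ring R]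

/-- The variable `u_x`, as a power series. -/
noncomputable def var (x : σ) : NCPowerSeries σ R := fun w => if w = [x] then 1 else 0

/-- The geometric series `1 - u_x + u_x ^ 2 - ⋯`. -/
noncomputable def altGeom (x : σ) : NCPowerSeries σ R :=
  fun w => if ∀ y ∈ w, y = x then (-1) ^ w.length else 0

theorem tail_var (a x : σ) : tail a (var R x) = if a = x then 1 else 0 := by
  refine ext fun w => ?_
  by_cases h : a = x <;> cases w <;> simp [tail, var, h, one_nil, one_cons, zero_apply]

theorem tail_altGeom (a x : σ) :
    tail a (altGeom R x) = if a = x then -altGeom R x else 0 := by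
  refine ext fun w => ?_
  by_cases h : a = x
  · rw [if_pos h]
    change altGeom R x (a :: w) = -(altGeom R x w)
    simp only [altGeom, List.forall_mem_cons, h, true_and, List.length_cons, pow_succ]
    split_ifs <;> simp
  · simp [tail, altGeom, h, zero_apply]

theorem one_add_var_mul_altGeom (x : σ) : (1 + var R x) * altGeom R x = 1 := by
  rw [add_mul, one_mul]
  refine ext fun w => ?_
  cases w with
  | nil => simp [add_apply, mul_nil, var, altGeom, one_nil]
  | cons a w =>
    have h := congrFun (tail_altGeom R a x) w
    change altGeom R x (a :: w) = _ at h
    rw [add_apply, mul_cons, tail_var, h, one_cons]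
    by_cases hx : a = x
    · simp [hx, var, ← add_apply, zero_apply]
    · simp [hx, var, zero_apply]

theorem altGeom_mul_one_add_var (x : σ) : altGeom R x * (1 + var R x) = 1 := by
  refine ext fun w => ?_
  induction w with
  | nil => simp [add_apply, mul_nil, var, altGeom, one_nil]
  | cons a w ih =>
    rw [mul_cons, tail_altGeom, add_apply, one_cons]
    have h := congrFun (tail_var R a x) w
    change var R x (a :: w) = _ at h
    by_cases hx : a = x
    · rw [if_pos hx, neg_mul]
      change -((altGeom R x * (1 + var R x)) w) + _ = _
      rw [ih, h]
      simp [hx, altGeom]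
    · simp [hx, h, zero_apply]

/-- The unit `1 + u_x` of the ring of non-commutative formal power series. -/
noncomputable def oneAddVar (x : σ) : (NCPowerSeries σ R)ˣ where
  val := 1 + var R x
  inv := altGeom R x
  val_inv := one_add_var_mul_altGeom R x
  inv_val := altGeom_mul_one_add_var R x

variable (σ) in
/-- The (two-sided) ideal generated by the variables `u_x`. -/
noncomputable def augIdeal : Ideal (NCPowerSeries σ R) :=
  TwoSidedIdeal.asIdeal (TwoSidedIdeal.span (Set.range (var R)))

end Magnus

end NCPowerSeries

section GolodShafarevich

variable (p : ℕ) {X : Type*} [DecidableEq X]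

/-- The Magnus embedding `F(X) → Λ_pˣ`, `x ↦ 1 + u_x`, where `Λ_p = 𝔽_p⟨⟨u_x : x ∈ X⟩⟩`. -/
noncomputable def magnus : FreeGroup X →* (NCPowerSeries X (ZMod p))ˣ :=
  FreeGroup.lift fun x => NCPowerSeries.oneAddVar (ZMod p) x

variable (X) in
/-- The `n`-th term `D_n F(X) = {f | f ≡ 1 mod I ^ n}` of the Zassenhaus `p`-series. -/
def zassenhaus (n : ℕ) : Set (FreeGroup X) :=
  {f | (magnus p f : NCPowerSeries X (ZMod p)) - 1 ∈ NCPowerSeries.augIdeal X (ZMod p) ^ n}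

/-- The elements of `R` of degree `n` with respect to the Zassenhaus `p`-series. -/
def relatorsOfDegree (R : Set (FreeGroup X)) (n : ℕ) : Set (FreeGroup X) :=
  R ∩ (zassenhaus p X n \ zassenhaus p X (n + 1))

/-- The pro-`p` completion of a group `G`: the inverse limit of the quotients `G ⧸ N`, where `N`
ranges over the normal subgroups of `G` whose index is a (finite) power of `p`. -/
def proPCompletion (G : Type*) [Group G] :
    Subgroup (∀ N : {N : FiniteIndexNormalSubgroup G // ∃ k : ℕ, N.toSubgroup.index = p ^ k},
      G ⧸ N.1.toSubgroup) where
  carrier := {x | ∀ M N, ∀ h : M.1.toSubgroup ≤ N.1.toSubgroup,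
    QuotientGroup.map M.1.toSubgroup N.1.toSubgroup (MonoidHom.id G) h (x M) = x N}
  one_mem' := fun M N h => by simp
  mul_mem' := fun {x y} hx hy M N h => by
    rw [Pi.mul_apply, Pi.mul_apply, map_mul, hx M N h, hy M N h]
  inv_mem' := fun {x} hx M N h => by rw [Pi.inv_apply, Pi.inv_apply, map_inv, hx M N h]

/-- The inverse limit topology on the pro-`p` completion (each quotient `G ⧸ N` is discrete). -/
instance proPCompletion.topologicalSpace (G : Type*) [Group G] :
    TopologicalSpace (proPCompletion p G) :=
  TopologicalSpace.induced Subtype.val (@Pi.topologicalSpace _ _ fun _ => ⊥)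

/-- The minimal number of topological generators of the pro-`p` completion of `G`. (Used only for
finitely generated `G`, for which a finite set of topological generators exists.) -/
noncomputable def proPRank (G : Type*) [Group G] : ℕ :=
  sInf {n | ∃ s : Finset (proPCompletion p G), s.card = n ∧
    Dense (Subgroup.closure (s : Set (proPCompletion p G)) : Set (proPCompletion p G))}

/-- The presentation `⟨X | R⟩` is Golod-Shafarevich with respect to the prime `p`: for some
`0 < t₀ < 1` the series `H_p(X, R, t) = 1 - d̂ t + ∑_{i ≥ 1} n_i(R) t ^ i` has finite coefficients,
converges at `t₀`, and `H_p(X, R, t₀) < 0`. Here `n_i(R)` is the number of relators of degree `i`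
and `d̂` is the minimal number of topological generators of the pro-`p` completion of the group
`⟨X | R⟩`. -/
def IsGolodShafarevich (R : Set (FreeGroup X)) : Prop :=
  (∀ i : ℕ, 1 ≤ i → (relatorsOfDegree p R i).Finite) ∧
  ∃ t₀ : ℝ, 0 < t₀ ∧ t₀ < 1 ∧
    Summable (fun i : ℕ => ((relatorsOfDegree p R (i + 1)).ncard : ℝ) * t₀ ^ (i + 1)) ∧
    1 - (proPRank p (PresentedGroup R) : ℝ) * t₀ +
      ∑' i : ℕ, ((relatorsOfDegree p R (i + 1)).ncard : ℝ) * t₀ ^ (i + 1) < 0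

end GolodShafarevich

/-- A set of elements of the free group `F(x_1, …, x_d)` is computably enumerable if the set of all
words (finite sequences of letters `x_i ^ ±1`, not necessarily reduced) that represent its elements
is computably enumerable. As free reduction is computable, this is the same as computable
enumerability of the set of the reduced words of its elements. -/
def IsCESet {d : ℕ} (B : Set (FreeGroup (Fin d))) : Prop :=
  REPred fun w : List (Fin d × Bool) => FreeGroup.mk w ∈ B

/-- Simple sets of relations in the free group `F(x_1, …, x_d)`. -/
structure IsSimpleSetOfRelations {d : ℕ} (R : Set (FreeGroup (Fin d))) : Prop where
  ce : IsCESet R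
  infinite : Infinite (PresentedGroup R)
  meets : ∀ B : Set (FreeGroup (Fin d)), B.Infinite → IsCESet B →
    ∃ u ∈ B, ∃ v ∈ B, u ≠ v ∧ u * v⁻¹ ∈ R

/-! The construction imitates Post's simple set. Fix a large `N`. For the `e`-th computably
enumerable set of words, wait until two enumerated words represent distinct elements `u`, `v` with
`u * v⁻¹` in the dimension subgroup of index `N + e`, and put `u * v⁻¹` into `R` for the first such
pair found. The search is effective, because membership in a dimension subgroup amounts to counting
subwords modulo `p` (`mk_mem_dimensionSubgroup_iff`). It succeeds for every infinite set by the
pigeonhole principle, since only finitely many coefficients matter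
(`exists_ne_mul_inv_mem_dimensionSubgroup`).

Each `e` contributes at most one relator, and that relator lies in depth `N + e`. This sparseness
gives the other two properties.

The group `⟨X | R⟩` is infinite. Let `b n` be the dimension of the dual of the quotient of
`𝔽_p⟨⟨X⟩⟩` by the relators and by all words of length at least `n`. A rank-nullity form of the
Golod–Shafarevich inequality (`one_add_card_mul_finrank_annihilated_le`) forces `n ≤ b n`, whereas
`b n` is at most the order of the group if that is finite.

The presentation `⟨X | S ∪ R⟩` stays Golod–Shafarevich at the same `t₀`. The new relators add at
most a tail of a convergent series, which is below the slack in the strict inequality for large `N`.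
The rank `d̂` does not drop: it is the dimension of `Hom(G, 𝔽_p)` (`proPRank_eq_finrank`), and
homomorphisms to `𝔽_p` do not see relators of depth at least 2. -/

namespace NCPowerSeries

/-! ### The filtration of power series by order, and powers of the augmentation ideal. -/

section Order

variable {σ R : Type*} [Ring R]

/-- The series all of whose coefficients at words of length less than `n` vanish. -/
def orderGE (σ R : Type*) [Ring R] (n : ℕ) : AddSubgroup (NCPowerSeries σ R) where
  carrier := {f | ∀ w, w.length < n → f w = 0}
  zero_mem' := fun w _ => zero_apply w
  add_mem' := fun {f g} hf hg w hw => by rw [add_apply, hf w hw, hg w hw, add_zero]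
  neg_mem' := fun {f} hf w hw => by
    change -(f w) = 0
    rw [hf w hw, neg_zero]

theorem mem_orderGE {n : ℕ} {f : NCPowerSeries σ R} :
    f ∈ orderGE σ R n ↔ ∀ w, w.length < n → f w = 0 := Iff.rfl

theorem sub_apply (f g : NCPowerSeries σ R) (w : List σ) : (f - g) w = f w - g w := rfl

theorem sum_apply {ι : Type*} (s : Finset ι) (f : ι → NCPowerSeries σ R) (w : List σ) :
    (∑ i ∈ s, f i) w = ∑ i ∈ s, f i w := by
  classical
  induction s using Finset.induction_on with
  | empty => simp [zero_apply]
  | insert a s ha ih => rw [Finset.sum_insert ha, Finset.sum_insert ha, add_apply, ih]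

theorem mem_orderGE_zero (f : NCPowerSeries σ R) : f ∈ orderGE σ R 0 :=
  fun _ hw => absurd hw (Nat.not_lt_zero _)

theorem orderGE_antitone {m n : ℕ} (h : m ≤ n) : orderGE σ R n ≤ orderGE σ R m :=
  fun _ hf w hw => hf w (hw.trans_le h)

theorem mul_mem_orderGE {m n : ℕ} {f g : NCPowerSeries σ R} (hf : f ∈ orderGE σ R m)
    (hg : g ∈ orderGE σ R n) : f * g ∈ orderGE σ R (m + n) := by
  intro w hw
  rw [mul_apply]
  refine Finset.sum_eq_zero fun i hi => ?_
  rw [Finset.mem_range] at hi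
  by_cases him : i < m
  · rw [hf _ (by rw [List.length_take]; omega), zero_mul]
  · rw [hg _ (by rw [List.length_drop]; omega), mul_zero]

theorem mul_mem_orderGE_left {n : ℕ} (f : NCPowerSeries σ R) {g : NCPowerSeries σ R}
    (hg : g ∈ orderGE σ R n) : f * g ∈ orderGE σ R n := by
  simpa using mul_mem_orderGE (mem_orderGE_zero f) hg

theorem mul_mem_orderGE_right {n : ℕ} {f : NCPowerSeries σ R} (hf : f ∈ orderGE σ R n)
    (g : NCPowerSeries σ R) : f * g ∈ orderGE σ R n := by
  simpa using mul_mem_orderGE hf (mem_orderGE_zero g)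

theorem tail_mem_orderGE {n : ℕ} {f : NCPowerSeries σ R} (hf : f ∈ orderGE σ R (n + 1)) (a : σ) :
    tail a f ∈ orderGE σ R n :=
  fun w hw => hf (a :: w) (by simpa using hw)

end Order

section Ideal

variable {σ : Type*} [DecidableEq σ] (R : Type*) [Ring R]

theorem var_mul_nil (x : σ) (f : NCPowerSeries σ R) : (var R x * f) [] = 0 := by
  simp [mul_nil, var]

theorem var_mul_cons (x a : σ) (f : NCPowerSeries σ R) (w : List σ) :
    (var R x * f) (a :: w) = if a = x then f w else 0 := by
  rw [mul_cons, tail_var]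
  by_cases h : a = x <;> simp [h, var, zero_apply]

theorem var_mem_orderGE (x : σ) : var R x ∈ orderGE σ R 1 := by
  intro w hw
  have : w = [] := by simpa using hw
  simp [this, var]

theorem eq_sum_var_mul_tail [Fintype σ] {f : NCPowerSeries σ R} (hf : f [] = 0) :
    f = ∑ x, var R x * tail x f := by
  refine ext fun w => ?_
  rw [sum_apply]
  cases w with
  | nil => simp [var_mul_nil, hf]
  | cons a w => simp [var_mul_cons, tail]

theorem var_mem_augIdeal (x : σ) : var R x ∈ augIdeal σ R :=
  TwoSidedIdeal.mem_asIdeal.2 (TwoSidedIdeal.subset_span ⟨x, rfl⟩)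

instance : (augIdeal σ R).IsTwoSided :=
  inferInstanceAs (TwoSidedIdeal.asIdeal _).IsTwoSided

theorem augIdeal_pow_antitone : Antitone fun n : ℕ => augIdeal σ R ^ n :=
  fun _ _ h => Ideal.pow_le_pow_right h

/-- Splitting off first letters writes `f` as a finite sum of `u_x * tail x f`, and each tail has
order one less. Only this inclusion is needed: it turns vanishing coefficients, which can be
computed, into lower bounds for the degree of a relator. -/
theorem orderGE_le_augIdeal_pow [Finite σ] (n : ℕ) {f : NCPowerSeries σ R}
    (hf : f ∈ orderGE σ R n) : f ∈ augIdeal σ R ^ n := by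
  have := Fintype.ofFinite σ
  induction n generalizing f with
  | zero => rw [Submodule.pow_zero, Ideal.one_eq_top]; trivial
  | succ n ih =>
    rw [eq_sum_var_mul_tail R (hf [] (by simp)), Ideal.IsTwoSided.pow_succ]
    exact Ideal.sum_mem _ fun x _ =>
      Ideal.mul_mem_mul (var_mem_augIdeal R x) (ih (tail_mem_orderGE hf x))

end Ideal

end NCPowerSeries

/-! ### Dimension subgroups of the free group. -/

section Depth

open NCPowerSeries

variable (p : ℕ) {X : Type*} [DecidableEq X]

variable (X) in
/-- The dimension subgroup of those `f` for which `π(f) - 1` has no terms of degree below `n`. -/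
noncomputable def dimensionSubgroup (n : ℕ) : Subgroup (FreeGroup X) where
  carrier := {f | (magnus p f : NCPowerSeries X (ZMod p)) - 1 ∈ orderGE X (ZMod p) n}
  one_mem' := by simp [zero_mem]
  mul_mem' := fun {f g} hf hg => by
    have h : ((magnus p (f * g) : (NCPowerSeries X (ZMod p))ˣ) : NCPowerSeries X (ZMod p)) - 1 =
        ((magnus p f : (NCPowerSeries X (ZMod p))ˣ) - 1) * (magnus p g : (NCPowerSeries X (ZMod p))ˣ) +
          ((magnus p g : (NCPowerSeries X (ZMod p))ˣ) - 1) := by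
      rw [map_mul, Units.val_mul]; noncomm_ring
    simp only [Set.mem_ofPred_eq] at hf hg ⊢
    rw [h]
    exact add_mem (mul_mem_orderGE_right hf _) hg
  inv_mem' := fun {f} hf => by
    have h : ((magnus p f⁻¹ : (NCPowerSeries X (ZMod p))ˣ) : NCPowerSeries X (ZMod p)) - 1 =
        -(((magnus p f : (NCPowerSeries X (ZMod p))ˣ) - 1) *
          ((magnus p f)⁻¹ : (NCPowerSeries X (ZMod p))ˣ)) := by
      rw [map_inv, sub_mul, Units.mul_inv, one_mul, neg_sub]
    simp only [Set.mem_ofPred_eq] at hf ⊢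
    rw [h]
    exact neg_mem (mul_mem_orderGE_right hf _)

theorem mem_dimensionSubgroup {n : ℕ} {f : FreeGroup X} : f ∈ dimensionSubgroup p X n ↔
    (magnus p f : NCPowerSeries X (ZMod p)) - 1 ∈ orderGE X (ZMod p) n := Iff.rfl

theorem dimensionSubgroup_antitone {m n : ℕ} (h : m ≤ n) :
    dimensionSubgroup p X n ≤ dimensionSubgroup p X m :=
  fun _ hf => orderGE_antitone h hf

theorem dimensionSubgroup_subset_zassenhaus [Finite X] (n : ℕ) :
    (dimensionSubgroup p X n : Set (FreeGroup X)) ⊆ zassenhaus p X n :=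
  fun _ hf => orderGE_le_augIdeal_pow (ZMod p) n hf

theorem zassenhaus_antitone : Antitone (zassenhaus p X) :=
  fun _ _ h _ hf => augIdeal_pow_antitone (ZMod p) h hf

variable {p} in
theorem relatorsOfDegree_union (S R : Set (FreeGroup X)) (n : ℕ) :
    relatorsOfDegree p (S ∪ R) n = relatorsOfDegree p S n ∪ relatorsOfDegree p R n :=
  Set.union_inter_distrib_right _ _ _

/-- `π(f g⁻¹) - 1` and `π(f) - π(g)` differ by the unit factor `π(g)`, and multiplication by a
series does not lower the order. -/
theorem mul_inv_mem_dimensionSubgroup_iff {n : ℕ} {f g : FreeGroup X} :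
    f * g⁻¹ ∈ dimensionSubgroup p X n ↔ ∀ w : List X, w.length < n →
      (magnus p f : NCPowerSeries X (ZMod p)) w = (magnus p g : NCPowerSeries X (ZMod p)) w := by
  have h : ((magnus p f : (NCPowerSeries X (ZMod p))ˣ) : NCPowerSeries X (ZMod p)) - magnus p g =
      ((magnus p (f * g⁻¹) : (NCPowerSeries X (ZMod p))ˣ) - 1) *
        (magnus p g : (NCPowerSeries X (ZMod p))ˣ) := by
    rw [map_mul, map_inv, sub_mul, ← Units.val_mul, inv_mul_cancel_right, one_mul]
  have h' : ((magnus p (f * g⁻¹) : (NCPowerSeries X (ZMod p))ˣ) : NCPowerSeries X (ZMod p)) - 1 =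
      ((magnus p f : (NCPowerSeries X (ZMod p))ˣ) - (magnus p g : (NCPowerSeries X (ZMod p))ˣ)) *
        ((magnus p g)⁻¹ : (NCPowerSeries X (ZMod p))ˣ) := by
    rw [h, mul_assoc, Units.mul_inv, mul_one]
  rw [mem_dimensionSubgroup]
  have key : ((magnus p (f * g⁻¹) : (NCPowerSeries X (ZMod p))ˣ) : NCPowerSeries X (ZMod p)) - 1
      ∈ orderGE X (ZMod p) n ↔
      ((magnus p f : (NCPowerSeries X (ZMod p))ˣ) : NCPowerSeries X (ZMod p)) - magnus p g
        ∈ orderGE X (ZMod p) n :=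
    ⟨fun hf => h ▸ mul_mem_orderGE_right hf _, fun hf => h' ▸ mul_mem_orderGE_right hf _⟩
  rw [key, mem_orderGE]
  simp only [NCPowerSeries.sub_apply, sub_eq_zero]

/-- An infinite set contains two distinct elements which are congruent modulo the `n`-th dimension
subgroup, as the latter has finite index. -/
theorem exists_ne_mul_inv_mem_dimensionSubgroup [NeZero p] [Finite X] (n : ℕ)
    {B : Set (FreeGroup X)} (hB : B.Infinite) :
    ∃ u ∈ B, ∃ v ∈ B, u ≠ v ∧ u * v⁻¹ ∈ dimensionSubgroup p X n := by
  have : Finite {w : List X // w.length < n} := List.finite_length_lt X n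
  obtain ⟨u, hu, v, hv, huv, h⟩ := hB.exists_ne_map_eq_of_mapsTo
    (f := fun (f : FreeGroup X) (w : {w : List X // w.length < n}) =>
      (magnus p f : NCPowerSeries X (ZMod p)) w.1)
    (t := Set.univ) (fun _ _ => Set.mem_univ _) Set.finite_univ
  exact ⟨u, hu, v, hv, huv, (mul_inv_mem_dimensionSubgroup_iff p).2
    fun w hw => congrFun h ⟨w, hw⟩⟩

end Depth

/-! ### The dual of the truncated algebra and the Golod–Shafarevich inequality. -/

namespace NCPowerSeries

section Action

variable {X K : Type*} [Field K]

variable (X K) in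
/-- The functions on words which vanish on words of length at least `n`. -/
def boundedSupport (n : ℕ) : Submodule K (List X → K) where
  carrier := {φ | ∀ w, n ≤ w.length → φ w = 0}
  zero_mem' := fun _ _ => rfl
  add_mem' := fun {φ ψ} hφ hψ w hw => by rw [Pi.add_apply, hφ w hw, hψ w hw, add_zero]
  smul_mem' := fun c φ hφ w hw => by rw [Pi.smul_apply, hφ w hw, smul_zero]

theorem boundedSupport_mono {m n : ℕ} (h : m ≤ n) : boundedSupport X K m ≤ boundedSupport X K n :=
  fun _ hφ w hw => hφ w (h.trans hw)

theorem eq_zero_of_mem_boundedSupport_zero {φ : List X → K} (h : φ ∈ boundedSupport X K 0) :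
    φ = 0 :=
  funext fun w => h w (Nat.zero_le _)

instance [Finite X] (n : ℕ) : FiniteDimensional K (boundedSupport X K n) := by
  have : Finite {w : List X // w.length < n} := List.finite_length_lt X n
  refine FiniteDimensional.of_injective
    ((LinearMap.funLeft K K (Subtype.val : {w : List X // w.length < n} → List X)).comp
      (boundedSupport X K n).subtype) fun φ ψ h => Subtype.ext (funext fun w => ?_)
  by_cases hw : w.length < n
  · exact congrFun h ⟨w, hw⟩
  · rw [φ.2 w (not_lt.1 hw), ψ.2 w (not_lt.1 hw)]

/-- Removal of the first letter `x`, the transpose of left multiplication by `u_x`. -/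
def shift (x : X) : (List X → K) →ₗ[K] (List X → K) := LinearMap.funLeft K K (List.cons x)

theorem shift_mem_boundedSupport {n : ℕ} {φ : List X → K} (h : φ ∈ boundedSupport X K (n + 1))
    (x : X) : shift x φ ∈ boundedSupport X K n :=
  fun w hw => h (x :: w) (by simpa using hw)

/-- The function on words with given constant term and given shifts. -/
def consFun : (K × (X → List X → K)) →ₗ[K] (List X → K) where
  toFun a
    | [] => a.1
    | x :: w => a.2 x w
  map_add' a b := by ext w; cases w <;> rfl
  map_smul' c a := by ext w; cases w <;> rfl

theorem consFun_injective : Function.Injective (consFun : (K × (X → List X → K)) →ₗ[K] _) := by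
  intro a b h
  refine Prod.ext (congrFun h []) (funext fun x => funext fun w => congrFun h (x :: w))

theorem consFun_mem_boundedSupport {n : ℕ} {a : K × (X → List X → K)}
    (ha : ∀ x, a.2 x ∈ boundedSupport X K n) : consFun a ∈ boundedSupport X K (n + 1) := by
  intro w hw
  cases w with
  | nil => simp at hw
  | cons x w => exact ha x w (by simpa using hw)

variable [Fintype X]

/-- The right action of power series on functions on words, the transpose of left multiplication;
only the coefficients at words of length below `n` are used. -/
def act : ℕ → NCPowerSeries X K → (List X → K) →ₗ[K] (List X → K)
  | 0, _ => 0
  -- This unfolds to `(φ · f)(w) = ∑ f v * φ (v ++ w)` over words `v` of length at most `n`, sorted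
  -- by the first letter of `v`. The bound keeps the sum finite and is harmless on functions of
  -- bounded support.
  | n + 1, f => f [] • LinearMap.id + ∑ x, (act n (tail x f)).comp (shift x)

theorem act_zero (f : NCPowerSeries X K) (φ : List X → K) : act 0 f φ = 0 := rfl

theorem act_succ (n : ℕ) (f : NCPowerSeries X K) (φ : List X → K) :
    act (n + 1) f φ = f [] • φ + ∑ x, act n (tail x f) (shift x φ) := by
  simp [act, LinearMap.sum_apply]

theorem act_add (n : ℕ) (f g : NCPowerSeries X K) (φ : List X → K) :
    act n (f + g) φ = act n f φ + act n g φ := by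
  induction n generalizing f g φ with
  | zero => simp [act_zero]
  | succ n ih =>
    have h : ∀ x, tail x (f + g) = tail x f + tail x g := fun _ => rfl
    simp only [act_succ, h, ih, add_apply, add_smul, Finset.sum_add_distrib]
    abel

theorem act_lscale (n : ℕ) (c : K) (f : NCPowerSeries X K) (φ : List X → K) :
    act n (lscale c f) φ = c • act n f φ := by
  induction n generalizing f φ with
  | zero => simp [act_zero]
  | succ n ih =>
    have h : ∀ x, tail x (lscale c f) = lscale c (tail x f) := fun _ => rfl
    simp only [act_succ, h, ih, smul_add, Finset.smul_sum, smul_smul]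
    rfl

theorem act_zero_left (n : ℕ) (φ : List X → K) : act n (0 : NCPowerSeries X K) φ = 0 := by
  simpa using act_add n 0 0 φ

theorem act_sub (n : ℕ) (f g : NCPowerSeries X K) (φ : List X → K) :
    act n (f - g) φ = act n f φ - act n g φ := by
  rw [eq_sub_iff_add_eq, ← act_add, sub_add_cancel]

theorem act_one {n : ℕ} {φ : List X → K} (hφ : φ ∈ boundedSupport X K n) :
    act n (1 : NCPowerSeries X K) φ = φ := by
  cases n with
  | zero => rw [eq_zero_of_mem_boundedSupport_zero hφ, map_zero]
  | succ n => simp [act_succ, tail_one, act_zero_left, one_nil]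

theorem act_eq_of_le {m n : ℕ} (h : n ≤ m) (f : NCPowerSeries X K) {φ : List X → K}
    (hφ : φ ∈ boundedSupport X K n) : act m f φ = act n f φ := by
  induction n generalizing m f φ with
  | zero => rw [eq_zero_of_mem_boundedSupport_zero hφ, map_zero, map_zero]
  | succ n ih =>
    obtain ⟨m, rfl⟩ := Nat.exists_eq_add_of_le' (Nat.le_of_add_left_le h)
    simp only [act_succ]
    congr 1
    exact Finset.sum_congr rfl fun x _ =>
      ih (Nat.le_of_succ_le_succ h) _ (shift_mem_boundedSupport hφ x)

/-- Every contributing word removes at least `j` letters. With truncated subtraction the result is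
zero as soon as `k ≤ j`. -/
theorem act_mem_boundedSupport {j k : ℕ} (m : ℕ) {f : NCPowerSeries X K} {φ : List X → K}
    (hf : f ∈ orderGE X K j) (hφ : φ ∈ boundedSupport X K k) :
    act m f φ ∈ boundedSupport X K (k - j) := by
  induction m generalizing j k f φ with
  | zero => exact zero_mem _
  | succ m ih =>
    rw [act_succ]
    cases k with
    | zero =>
      rw [eq_zero_of_mem_boundedSupport_zero hφ]
      simp
    | succ k =>
      cases j with
      | zero =>
        exact add_mem (Submodule.smul_mem _ _ hφ) (Submodule.sum_mem _ fun x _ =>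
          boundedSupport_mono (Nat.le_succ k)
            (ih (mem_orderGE_zero _) (shift_mem_boundedSupport hφ x)))
      | succ j =>
        rw [hf [] (by simp), zero_smul, zero_add, Nat.succ_sub_succ]
        exact Submodule.sum_mem _ fun x _ =>
          ih (tail_mem_orderGE hf x) (shift_mem_boundedSupport hφ x)

theorem act_mem (n : ℕ) (f : NCPowerSeries X K) {k : ℕ} {φ : List X → K}
    (hφ : φ ∈ boundedSupport X K k) : act n f φ ∈ boundedSupport X K k :=
  act_mem_boundedSupport n (mem_orderGE_zero f) hφ

theorem act_succ_mul (n : ℕ) (f g : NCPowerSeries X K) (φ : List X → K) :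
    act (n + 1) (f * g) φ = f [] • act (n + 1) g φ + ∑ x, act n (tail x f * g) (shift x φ) := by
  simp only [act_succ, tail_mul, act_add, act_lscale, Finset.sum_add_distrib, mul_nil, smul_add,
    Finset.smul_sum, mul_smul]
  abel

theorem act_act {n : ℕ} (f g : NCPowerSeries X K) {φ : List X → K}
    (hφ : φ ∈ boundedSupport X K n) : act n g (act n f φ) = act n (f * g) φ := by
  induction n generalizing f φ with
  | zero => rw [eq_zero_of_mem_boundedSupport_zero hφ]; simp
  | succ n ih =>
    rw [act_succ_mul, act_succ n f, map_add, map_smul, map_sum]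
    congr 1
    refine Finset.sum_congr rfl fun x _ => ?_
    have hx := shift_mem_boundedSupport hφ x
    rw [act_eq_of_le (Nat.le_succ n) g (act_mem n _ hx), ih _ hx]

theorem act_var [DecidableEq X] {n : ℕ} {φ : List X → K} (hφ : φ ∈ boundedSupport X K n) (x : X) :
    act n (var K x) φ = shift x φ := by
  cases n with
  | zero => rw [eq_zero_of_mem_boundedSupport_zero hφ]; simp
  | succ n =>
    rw [act_succ, Finset.sum_eq_single x]
    · rw [tail_var, if_pos rfl, act_one (shift_mem_boundedSupport hφ x)]
      simp [var]
    · intro y _ hy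
      rw [tail_var, if_neg hy, act_zero_left]
    · simp

/-- The functions supported on words of length less than `n` which are annihilated by the two-sided
ideal generated by the series `ρ i`. -/
def annihilated {ι : Type*} (ρ : ι → NCPowerSeries X K) (n : ℕ) : Submodule K (List X → K) where
  -- Left multiples of `ρ i` suffice: since `act` is a right action, a `φ` killed by `f * ρ i` is
  -- killed by `f * ρ i * g` as well.
  carrier := {φ | φ ∈ boundedSupport X K n ∧ ∀ f i, act n (f * ρ i) φ = 0}
  zero_mem' := ⟨zero_mem _, fun _ _ => map_zero _⟩
  add_mem' := fun hφ hψ => ⟨add_mem hφ.1 hψ.1, fun f i => by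
    rw [map_add, hφ.2, hψ.2, add_zero]⟩
  smul_mem' := fun c φ hφ => ⟨Submodule.smul_mem _ c hφ.1, fun f i => by
    rw [map_smul, hφ.2, smul_zero]⟩

section Annihilated

variable {ι : Type*} {ρ : ι → NCPowerSeries X K}

theorem annihilated_le (n : ℕ) : annihilated ρ n ≤ boundedSupport X K n := fun _ h => h.1

instance (n : ℕ) : FiniteDimensional K (annihilated ρ n) :=
  Submodule.finiteDimensional_of_le (annihilated_le n)

theorem act_mem_annihilated {n : ℕ} {φ : List X → K} (hφ : φ ∈ annihilated ρ n)
    (g : NCPowerSeries X K) : act n g φ ∈ annihilated ρ n :=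
  ⟨act_mem n g hφ.1, fun f i => by rw [act_act _ _ hφ.1, ← mul_assoc, hφ.2]⟩

theorem act_eq_zero_of_mem_annihilated {n : ℕ} {φ : List X → K} (hφ : φ ∈ annihilated ρ n)
    (i : ι) : act n (ρ i) φ = 0 := by
  rw [← one_mul (ρ i), hφ.2]

theorem mem_annihilated_iff_of_le {m n : ℕ} (h : n ≤ m) {φ : List X → K}
    (hφ : φ ∈ boundedSupport X K n) : φ ∈ annihilated ρ m ↔ φ ∈ annihilated ρ n :=
  ⟨fun hm => ⟨hφ, fun f i => by rw [← act_eq_of_le h _ hφ, hm.2]⟩,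
    fun hn => ⟨boundedSupport_mono h hφ, fun f i => by rw [act_eq_of_le h _ hφ, hn.2]⟩⟩

theorem annihilated_mono {m n : ℕ} (h : n ≤ m) : annihilated ρ n ≤ annihilated ρ m :=
  fun _ hφ => (mem_annihilated_iff_of_le h hφ.1).2 hφ

/-- Decompose `f * ρ i` by the first letter of `f`: the constant term gives a multiple of `ρ i`, and
every other term acts through a shift of `φ`. -/
theorem mem_annihilated_succ {n : ℕ} {φ : List X → K} (hφ : φ ∈ boundedSupport X K (n + 1))
    (hs : ∀ x, shift x φ ∈ annihilated ρ n) (h0 : ∀ i, act (n + 1) (ρ i) φ = 0) :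
    φ ∈ annihilated ρ (n + 1) :=
  ⟨hφ, fun f i => by
    rw [act_succ_mul, h0, smul_zero, zero_add]
    exact Finset.sum_eq_zero fun x _ => (hs x).2 _ _⟩

/-- As `f` has no constant term, `φ · f` is a sum of images of the shifts of `φ`, which lie in an
invariant subspace. The order of `f` then improves the support bound. -/
theorem act_succ_mem_annihilated {n j : ℕ} {φ : List X → K}
    (hφ : φ ∈ boundedSupport X K (n + 1)) (hs : ∀ x, shift x φ ∈ annihilated ρ n)
    {f : NCPowerSeries X K} (hf : f ∈ orderGE X K (j + 1)) :
    act (n + 1) f φ ∈ annihilated ρ (n + 1 - (j + 1)) := by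
  refine (mem_annihilated_iff_of_le (m := n) (by omega) (act_mem_boundedSupport _ hf hφ)).1 ?_
  rw [act_succ, hf [] (by simp), zero_smul, zero_add]
  exact Submodule.sum_mem _ fun x _ => act_mem_annihilated (hs x) _

/-- The Golod-Shafarevich inequality. -/
theorem one_add_card_mul_finrank_annihilated_le {ρ : ℕ → NCPowerSeries X K} {N : ℕ}
    (hρ : ∀ e, ρ e ∈ orderGE X K (N + 1 + e)) (n : ℕ) :
    1 + Fintype.card X * Module.finrank K (annihilated ρ n) ≤
      Module.finrank K (annihilated ρ (n + 1)) +
        ∑ e : Fin (n + 1), Module.finrank K (annihilated ρ (n + 1 - (N + 1 + e))) := by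
  -- The functions all of whose shifts are annihilated: a constant term and one annihilated function
  -- per letter, so the dimension is `1 + d * b n`.
  let ext : (K × (X → annihilated ρ n)) →ₗ[K] (List X → K) :=
    consFun.comp (LinearMap.prodMap LinearMap.id
      (LinearMap.pi fun x => (annihilated ρ n).subtype.comp (LinearMap.proj x)))
  have ext_bdd : ∀ a, ext a ∈ boundedSupport X K (n + 1) := fun a =>
    consFun_mem_boundedSupport fun x => (a.2 x).2.1
  have ext_shift : ∀ a x, shift x (ext a) ∈ annihilated ρ n := fun a x => (a.2 x).2
  have ext_inj : Function.Injective ext := by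
    intro a b h
    have h' := consFun_injective h
    refine Prod.ext (congrFun h []) (funext fun x => Subtype.ext ?_)
    exact congrFun (congrArg Prod.snd h') x
  -- By `mem_annihilated_succ` the only remaining obstructions are the values `φ · ρ e`.
  -- Rank-nullity for the map recording them gives the inequality.
  let Θ : (K × (X → annihilated ρ n)) →ₗ[K]
      ((e : Fin (n + 1)) → annihilated ρ (n + 1 - (N + 1 + e))) :=
    LinearMap.pi fun e => LinearMap.codRestrict _ ((act (n + 1) (ρ e)).comp ext) fun a => by
      have h := hρ e
      rw [show N + 1 + (e : ℕ) = N + e + 1 by omega] at h ⊢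
      exact act_succ_mem_annihilated (ext_bdd a) (ext_shift a) h
  have hker : Module.finrank K (LinearMap.ker Θ) ≤ Module.finrank K (annihilated ρ (n + 1)) := by
    refine LinearMap.finrank_le_finrank_of_injective
      (f := LinearMap.codRestrict _ (ext.comp (LinearMap.ker Θ).subtype) fun a => ?_) ?_
    · refine mem_annihilated_succ (ext_bdd _) (ext_shift _) fun e => ?_
      by_cases he : e < n + 1
      · exact congrArg Subtype.val (congrFun (LinearMap.mem_ker.1 a.2) ⟨e, he⟩)
      -- For `e > n` the order of `ρ e` exceeds the support bound, so there is no obstruction.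
      · have h := act_mem_boundedSupport (n + 1) (hρ e) (ext_bdd a)
        rw [show n + 1 - (N + 1 + e) = 0 by omega] at h
        exact eq_zero_of_mem_boundedSupport_zero h
    · intro a b h
      exact Subtype.ext (ext_inj (congrArg Subtype.val h))
  have hrange : Module.finrank K (LinearMap.range Θ) ≤
      ∑ e : Fin (n + 1), Module.finrank K (annihilated ρ (n + 1 - (N + 1 + e))) := by
    rw [← Module.finrank_pi_fintype]
    exact Submodule.finrank_le _
  have h := LinearMap.finrank_range_add_finrank_ker Θ
  rw [Module.finrank_prod, Module.finrank_self, Module.finrank_pi_fintype, Finset.sum_const,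
    Finset.card_univ, smul_eq_mul] at h
  omega

end Annihilated

end Action

end NCPowerSeries

/-- The correction `c n` is at most half of `b n`, so `b` grows by a factor of at least 3/2 per
step. Terms with truncated indices vanish because `b 0 = 0`. -/
theorem le_of_golodShafarevich_recursion {d N : ℕ} (hd : 2 ≤ d) (hN : 5 ≤ N) {b : ℕ → ℕ}
    (hb0 : b 0 = 0) (hb : Monotone b)
    (h : ∀ n, 1 + d * b n ≤ b (n + 1) + ∑ e : Fin (n + 1), b (n + 1 - (N + 1 + e))) (n : ℕ) :
    n ≤ b n := by
  set c : ℕ → ℕ := fun n => ∑ e ∈ Finset.range (n + 1), b (n - (N + e)) with hc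
  have hrec : ∀ n, 1 + 2 * b n ≤ b (n + 1) + c n := by
    intro n
    have h1 := h n
    rw [Finset.sum_fin_eq_sum_range] at h1
    have h2 : ∑ i ∈ Finset.range (n + 1),
        (if h : i < n + 1 then b (n + 1 - (N + 1 + (⟨i, h⟩ : Fin (n + 1)))) else 0) = c n := by
      refine Finset.sum_congr rfl fun i hi => ?_
      rw [dif_pos (Finset.mem_range.1 hi)]
      congr 1
      simp only
      omega
    rw [h2] at h1
    have := Nat.mul_le_mul_right (b n) hd
    omega
  have hcs : ∀ n, c (n + 1) = b (n + 1 - N) + c n := by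
    intro n
    simp only [hc]
    rw [Finset.sum_range_succ', add_comm]
    congr 1
    refine Finset.sum_congr rfl fun i _ => ?_
    congr 1
    omega
  have key : ∀ n, 2 * c n ≤ b n := by
    intro n
    induction n using Nat.strong_induction_on with
    | _ n ih =>
      cases n with
      | zero => simp [hc, hb0]
      | succ n =>
        have growth : ∀ k ≤ n, 3 * b k + 2 ≤ 2 * b (k + 1) := fun k hk => by
          have := ih k (by omega)
          have := hrec k
          omega
        -- Since `N ≥ 5`, at least four growth steps separate the indices, and `(3/2)^4 > 4`. The
        -- new term of `c (n + 1)` is thus at most `b n / 4`, which closes the induction.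
        have h4 : 4 * b (n + 1 - N) ≤ b n := by
          by_cases hn : n + 1 < N
          · rw [Nat.sub_eq_zero_of_le hn.le, hb0]; omega
          · obtain ⟨k, rfl⟩ : ∃ k, n = k + 4 := ⟨n - 4, by omega⟩
            have h0 : b (k + 4 + 1 - N) ≤ b k := hb (by omega)
            have := growth k (by omega)
            have := growth (k + 1) (by omega)
            have := growth (k + 2) (by omega)
            have := growth (k + 3) (by omega)
            simp only [add_assoc, Nat.reduceAdd] at *
            omega
        have := growth n le_rfl
        have := ih n (by omega)
        rw [hcs]
        omega
  induction n with
  | zero => omega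
  | succ n ih =>
    have := key n
    have := hrec n
    omega

/-! ### Infinitude of groups with sparse deep relators. -/

section Infinite

open NCPowerSeries

variable (p : ℕ) [Fact p.Prime] {X : Type*} [DecidableEq X] [Fintype X]

/-- The action of `f` in the free group on functions on words through the Magnus embedding. -/
noncomputable def magnusAct (n : ℕ) (f : FreeGroup X) :
    (List X → ZMod p) →ₗ[ZMod p] (List X → ZMod p) :=
  act n (magnus p f : NCPowerSeries X (ZMod p))

variable {p}

theorem magnusAct_one {n : ℕ} {φ : List X → ZMod p} (hφ : φ ∈ boundedSupport X (ZMod p) n) :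
    magnusAct p n 1 φ = φ := by
  rw [magnusAct, map_one, Units.val_one, act_one hφ]

theorem magnusAct_mul {n : ℕ} (f g : FreeGroup X) {φ : List X → ZMod p}
    (hφ : φ ∈ boundedSupport X (ZMod p) n) :
    magnusAct p n (f * g) φ = magnusAct p n g (magnusAct p n f φ) := by
  rw [magnusAct, magnusAct, magnusAct, act_act _ _ hφ, map_mul, Units.val_mul]

/-- Functions on words are detected by the free group. -/
theorem eq_zero_of_magnusAct_nil_eq_zero {n : ℕ} {φ : List X → ZMod p}
    (hφ : φ ∈ boundedSupport X (ZMod p) n) (h : ∀ f : FreeGroup X, magnusAct p n f φ [] = 0) :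
    φ = 0 := by
  funext w
  induction w generalizing φ with
  | nil => exact (congrFun (magnusAct_one hφ) []).symm.trans (h 1)
  | cons x w ih =>
    have hx : shift x φ ∈ boundedSupport X (ZMod p) n := by
      rw [← act_var hφ]
      exact act_mem n _ hφ
    refine ih hx fun f => ?_
    -- As `π(x) = 1 + u_x`, the shift is the action of `x - 1`, so it inherits the vanishing
    -- hypothesis.
    have h1 : shift x φ = magnusAct p n (FreeGroup.of x) φ - φ := by
      have : (magnus p (FreeGroup.of x) : NCPowerSeries X (ZMod p)) = 1 + var (ZMod p) x := by
        rw [magnus, FreeGroup.lift_apply_of]; rfl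
      rw [magnusAct, this, act_add, act_one hφ, act_var hφ, add_sub_cancel_left]
    rw [h1, map_sub, ← magnusAct_mul _ _ hφ, Pi.sub_apply, h, h, sub_zero]

variable (r : ℕ → FreeGroup X)

/-- The functions supported on words of length less than `n` on which the relators `r i` act
trivially. -/
noncomputable abbrev relatorInvariants (n : ℕ) : Submodule (ZMod p) (List X → ZMod p) :=
  annihilated (fun i => (magnus p (r i) : NCPowerSeries X (ZMod p)) - 1) n

theorem magnusAct_mem_relatorInvariants {n : ℕ} {φ : List X → ZMod p}
    (hφ : φ ∈ relatorInvariants r n) (f : FreeGroup X) :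
    magnusAct p n f φ ∈ relatorInvariants r n :=
  act_mem_annihilated hφ _

/-- The elements of the free group acting trivially on `relatorInvariants`. -/
noncomputable def actingTrivially (p : ℕ) [Fact p.Prime] (n : ℕ) : Subgroup (FreeGroup X) where
  carrier := {f | ∀ φ ∈ relatorInvariants (p := p) r n, magnusAct p n f φ = φ}
  one_mem' := fun _ hφ => magnusAct_one hφ.1
  mul_mem' := fun {f g} hf hg φ hφ => by rw [magnusAct_mul _ _ hφ.1, hf φ hφ, hg φ hφ]
  inv_mem' := fun {f} hf φ hφ => by
    conv_lhs => rw [← hf φ hφ]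
    rw [← magnusAct_mul _ _ hφ.1, mul_inv_cancel, magnusAct_one hφ.1]

instance (n : ℕ) : (actingTrivially r p n).Normal where
  conj_mem f hf g φ hφ := by
    rw [magnusAct_mul _ _ hφ.1, magnusAct_mul _ _ hφ.1,
      hf _ (magnusAct_mem_relatorInvariants r hφ _), ← magnusAct_mul _ _ hφ.1, mul_inv_cancel,
      magnusAct_one hφ.1]

theorem mem_actingTrivially (n i : ℕ) : r i ∈ actingTrivially r p n := fun φ hφ => by
  have h := act_eq_zero_of_mem_annihilated hφ i
  rwa [act_sub, act_one hφ.1, sub_eq_zero] at h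

/-- A group defined by relators in rapidly descending dimension subgroups is infinite. -/
theorem infinite_presentedGroup_of_mem_dimensionSubgroup (hd : 2 ≤ Fintype.card X) {N : ℕ}
    (hN : 6 ≤ N) (hr : ∀ e, r e ∈ dimensionSubgroup p X (N + e)) {R : Set (FreeGroup X)}
    (hR : R ⊆ Set.range r) : Infinite (PresentedGroup R) := by
  refine not_finite_iff_infinite.1 fun hfin => ?_
  have := Fintype.ofFinite (PresentedGroup R)
  obtain ⟨N, rfl⟩ := Nat.exists_eq_add_of_le' (show 1 ≤ N by omega)
  set b : ℕ → ℕ := fun n => Module.finrank (ZMod p) (relatorInvariants (p := p) r n) with hb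
  have hgrow : ∀ n, n ≤ b n := by
    refine le_of_golodShafarevich_recursion hd (N := N) (by omega) ?_ ?_ ?_
    · have : relatorInvariants (p := p) r 0 = ⊥ :=
        eq_bot_iff.2 fun φ hφ => eq_zero_of_mem_boundedSupport_zero hφ.1
      change Module.finrank (ZMod p) (relatorInvariants (p := p) r 0) = 0
      rw [this]
      exact finrank_bot _ _
    · exact fun m n h => Submodule.finrank_mono (annihilated_mono h)
    · exact one_add_card_mul_finrank_annihilated_le hr
  have hbound : ∀ n, b n ≤ Fintype.card (PresentedGroup R) := by
    intro n
    have hle : Subgroup.normalClosure R ≤ actingTrivially r p n :=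
      Subgroup.normalClosure_le_normal fun f hf => by
        obtain ⟨i, rfl⟩ := hR hf
        exact mem_actingTrivially r n i
    -- Matrix coefficients at the empty word. The normal closure of `R` acts trivially, so one
    -- representative per group element detects `φ`, which bounds the dimension by the group order.
    let L : relatorInvariants (p := p) r n →ₗ[ZMod p] (PresentedGroup R → ZMod p) :=
      LinearMap.pi fun g => (LinearMap.proj []).comp
        ((magnusAct p n (Quotient.out g)).comp (Submodule.subtype _))
    have hL : Function.Injective L := by
      refine (injective_iff_map_eq_zero L).2 fun φ hφ => Subtype.ext ?_
      refine eq_zero_of_magnusAct_nil_eq_zero φ.2.1 fun f => ?_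
      have h1 : magnusAct p n (Quotient.out (QuotientGroup.mk f : PresentedGroup R)) φ.1 [] = 0 :=
        congrFun hφ (QuotientGroup.mk f)
      obtain ⟨h, hh⟩ := QuotientGroup.mk_out_eq_mul (Subgroup.normalClosure R) f
      have h2 : f = Quotient.out (QuotientGroup.mk f : PresentedGroup R) * (h : FreeGroup X)⁻¹ := by
        rw [eq_mul_inv_iff_mul_eq]
        exact hh.symm
      rw [h2, magnusAct_mul _ _ φ.2.1, hle (inv_mem h.2) _ (magnusAct_mem_relatorInvariants r φ.2 _), h1]
    have := LinearMap.finrank_le_finrank_of_injective hL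
    rwa [Module.finrank_fintype_fun_eq_card] at this
  have := hgrow (Fintype.card (PresentedGroup R) + 1)
  have := hbound (Fintype.card (PresentedGroup R) + 1)
  omega

end Infinite

/-! ### The rank of the pro-`p` completion as the dimension of `Hom(G, 𝔽_p)`. -/

section ProPRank

variable {p : ℕ} {G : Type*} [Group G]

variable (p G) in
/-- The index set of the inverse system defining the pro-`p` completion. -/
abbrev PPowerIndexSubgroup :=
  {N : FiniteIndexNormalSubgroup G // ∃ k : ℕ, N.toSubgroup.index = p ^ k}

theorem PPowerIndexSubgroup.isPGroup (N : PPowerIndexSubgroup p G) :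
    IsPGroup p (G ⧸ N.1.toSubgroup) := by
  obtain ⟨k, hk⟩ := N.2
  exact IsPGroup.of_card (hk ▸ (Subgroup.index_eq_card _).symm)

theorem isOpen_proPCompletion_preimage (N : PPowerIndexSubgroup p G) (s : Set (G ⧸ N.1.toSubgroup)) :
    IsOpen {x : proPCompletion p G | x.1 N ∈ s} := by
  let _ : ∀ N : PPowerIndexSubgroup p G, TopologicalSpace (G ⧸ N.1.toSubgroup) := fun _ => ⊥
  have h : IsOpen {x : ∀ N : PPowerIndexSubgroup p G, G ⧸ N.1.toSubgroup | x N ∈ s} := by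
    have : @IsOpen _ (⊥ : TopologicalSpace (G ⧸ N.1.toSubgroup)) s := trivial
    exact this.preimage (continuous_apply N)
  exact isOpen_induced_iff.2 ⟨_, h, rfl⟩

variable (p) [Fact p.Prime]

variable (G) in
/-- The `𝔽_p`-vector space of homomorphisms from a group to `𝔽_p`. -/
abbrev ModPHom := Additive G →+ ZMod p

variable {p}

/-- The elements killed by a homomorphism to `𝔽_p`. -/
def ModPHom.ker (φ : ModPHom p G) : Subgroup G := φ.toMultiplicativeRight.ker

theorem ModPHom.mem_ker {φ : ModPHom p G} {g : G} : g ∈ φ.ker ↔ φ (Additive.ofMul g) = 0 :=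
  Iff.rfl

instance [Group.FG G] : FiniteDimensional (ZMod p) (ModPHom p G) := by
  obtain ⟨S, hS⟩ := Group.fg_def.1 ‹Group.FG G›
  let L : ModPHom p G →ₗ[ZMod p] (S → ZMod p) :=
    { toFun := fun φ s => φ (Additive.ofMul s.1)
      map_add' := fun _ _ => rfl
      map_smul' := fun _ _ => rfl }
  refine FiniteDimensional.of_injective L ((injective_iff_map_eq_zero L).2 fun φ hφ => ?_)
  have h : Subgroup.closure (S : Set G) ≤ φ.ker :=
    (Subgroup.closure_le _).2 fun s hs => congrFun hφ ⟨s, hs⟩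
  rw [hS] at h
  exact AddMonoidHom.ext fun g => h (Subgroup.mem_top g.toMul)

/-- A maximal subgroup of a finite `p`-group is the kernel of a homomorphism to `𝔽_p`. -/
theorem IsPGroup.exists_modPHom_ker_eq [Finite G] (hG : IsPGroup p G) {K : Subgroup G}
    (hK : IsCoatom K) : ∃ φ : ModPHom p G, φ.ker = K := by
  have := hG.isNilpotent
  have hn : K.Normal :=
    Subgroup.NormalizerCondition.normal_of_coatom K Group.normalizerCondition_of_isNilpotent hK
  have hQ : IsPGroup p (G ⧸ K) := hG.to_quotient K
  have hnt : Nontrivial (G ⧸ K) := QuotientGroup.nontrivial_iff.2 hK.1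
  obtain ⟨n, hn0, hn⟩ := (IsPGroup.nontrivial_iff_card hQ).1 hnt
  obtain ⟨x, hx⟩ := exists_prime_orderOf_dvd_card' (G := G ⧸ K) p
    (hn ▸ dvd_pow_self p hn0.ne')
  have hsurj : Function.Surjective (QuotientGroup.mk' K) := QuotientGroup.mk'_surjective K
  -- The preimage of `⟨x⟩` strictly contains the maximal subgroup `K`, hence is everything; so `G ⧸
  -- K` has order `p`.
  have htop : Subgroup.zpowers x = ⊤ := by
    have hle : K ≤ (Subgroup.zpowers x).comap (QuotientGroup.mk' K) := by
      conv_lhs => rw [← QuotientGroup.ker_mk' K]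
      exact MonoidHom.ker_le_comap _ _
    refine Subgroup.comap_injective hsurj ?_
    rw [Subgroup.comap_top]
    refine hK.2 _ (lt_of_le_of_ne hle fun h => ?_)
    have h1 : Subgroup.zpowers x = ⊥ := by
      refine Subgroup.comap_injective hsurj ?_
      rw [← h, MonoidHom.comap_bot, QuotientGroup.ker_mk']
    rw [Subgroup.zpowers_eq_bot] at h1
    rw [h1, orderOf_one] at hx
    exact (Fact.out : p.Prime).one_lt.ne hx
  have hcard : Nat.card (G ⧸ K) = p := by
    rw [← hx, ← Nat.card_zpowers, htop, Subgroup.card_top]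
  have hcard' : Nat.card (Multiplicative (ZMod p)) = p := by
    rw [Nat.card_congr Multiplicative.toAdd, Nat.card_zmod]
  let e := mulEquivOfPrimeCardEq hcard hcard'
  refine ⟨(e.toMonoidHom.comp (QuotientGroup.mk' K)).toAdditiveLeft, ?_⟩
  ext g
  rw [ModPHom.mem_ker]
  change e (QuotientGroup.mk g) = 1 ↔ _
  rw [map_eq_one_iff e e.injective, QuotientGroup.eq_one_iff]

/-- The Burnside basis theorem: elements on which no nonzero homomorphism to `𝔽_p` vanishes
generate every quotient which is a finite `p`-group. -/
theorem closure_sup_eq_top {t : Set G}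
    (ht : ∀ φ : ModPHom p G, (∀ g ∈ t, φ (Additive.ofMul g) = 0) → φ = 0)
    (N : Subgroup G) [N.Normal] [N.FiniteIndex] (hN : IsPGroup p (G ⧸ N)) :
    Subgroup.closure t ⊔ N = ⊤ := by
  have hsurj : Function.Surjective (QuotientGroup.mk' N) := QuotientGroup.mk'_surjective N
  have key : (Subgroup.closure t).map (QuotientGroup.mk' N) = ⊤ := by
    refine (eq_top_or_exists_le_coatom _).resolve_right ?_
    rintro ⟨K, hK, hle⟩
    obtain ⟨φ, hφ⟩ := hN.exists_modPHom_ker_eq hK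
    have h0 : φ.comp (QuotientGroup.mk' N).toAdditive = 0 := ht _ fun g hg => by
      change φ (Additive.ofMul (QuotientGroup.mk' N g)) = 0
      rw [← ModPHom.mem_ker, hφ]
      exact hle (Subgroup.mem_map_of_mem _ (Subgroup.subset_closure hg))
    refine hK.1 (eq_top_iff.2 fun q _ => ?_)
    obtain ⟨g, rfl⟩ := hsurj q
    rw [← hφ, ModPHom.mem_ker]
    exact DFunLike.congr_fun h0 (Additive.ofMul g)
  have := congrArg (Subgroup.comap (QuotientGroup.mk' N)) key
  rwa [Subgroup.comap_map_eq, QuotientGroup.ker_mk', Subgroup.comap_top] at this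

/-- A normal subgroup of finite index with quotient a `p`-group. -/
def PPowerIndexSubgroup.of (N : Subgroup G) [N.Normal] [N.FiniteIndex] (hN : IsPGroup p (G ⧸ N)) :
    PPowerIndexSubgroup p G :=
  ⟨{ toSubgroup := N }, by
    obtain ⟨k, hk⟩ := IsPGroup.iff_card.1 hN
    exact ⟨k, by rw [← hk, Subgroup.index_eq_card]⟩⟩

/-- Directedness of the inverse system, through intersections; it lets a single quotient describe a
neighbourhood in the completion. -/
theorem PPowerIndexSubgroup.exists_le (F : Finset (PPowerIndexSubgroup p G)) :
    ∃ M : PPowerIndexSubgroup p G, ∀ N ∈ F, M.1.toSubgroup ≤ N.1.toSubgroup := by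
  classical
  induction F using Finset.induction_on with
  | empty =>
    have : Subsingleton (G ⧸ (⊤ : Subgroup G)) := QuotientGroup.subsingleton_quotient_top
    exact ⟨of ⊤ (IsPGroup.of_subsingleton _ _), by simp⟩
  | insert N F _ ih =>
    obtain ⟨M, hM⟩ := ih
    refine ⟨of (N.1.toSubgroup ⊓ M.1.toSubgroup) ?_, fun K hK => ?_⟩
    · refine isPGroup_iff_pow_pow_eq_one.2 fun q => ?_
      obtain ⟨g, rfl⟩ := QuotientGroup.mk_surjective q
      obtain ⟨k, hk⟩ := isPGroup_iff_pow_pow_eq_one.1 N.isPGroup (g : G ⧸ N.1.toSubgroup)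
      obtain ⟨l, hl⟩ := isPGroup_iff_pow_pow_eq_one.1 M.isPGroup (g : G ⧸ M.1.toSubgroup)
      rw [← QuotientGroup.mk_pow, QuotientGroup.eq_one_iff] at hk hl
      refine ⟨k + l, ?_⟩
      rw [← QuotientGroup.mk_pow, QuotientGroup.eq_one_iff]
      refine ⟨?_, ?_⟩
      · rw [pow_add, pow_mul]
        exact Subgroup.pow_mem _ hk _
      · rw [pow_add, mul_comm, pow_mul]
        exact Subgroup.pow_mem _ hl _
    · rcases Finset.mem_insert.1 hK with rfl | hK
      · exact inf_le_left
      · exact inf_le_right.trans (hM K hK)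

variable (p G) in
/-- The canonical map to the pro-`p` completion. -/
def toProPCompletion : G →* proPCompletion p G where
  toFun g := ⟨fun N => (g : G ⧸ N.1.toSubgroup), fun _ _ _ => rfl⟩
  map_one' := rfl
  map_mul' _ _ := rfl

theorem exists_subset_of_isOpen_proPCompletion {U : Set (proPCompletion p G)} (hU : IsOpen U)
    {x : proPCompletion p G} (hx : x ∈ U) : ∃ M : PPowerIndexSubgroup p G,
      ∀ y : proPCompletion p G, y.1 M = x.1 M → y ∈ U := by
  let _ : ∀ N : PPowerIndexSubgroup p G, TopologicalSpace (G ⧸ N.1.toSubgroup) := fun _ => ⊥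
  obtain ⟨V, hV, rfl⟩ := isOpen_induced_iff.1 hU
  obtain ⟨F, u, hu, hsub⟩ := isOpen_pi_iff.1 hV x.1 hx
  obtain ⟨M, hM⟩ := PPowerIndexSubgroup.exists_le F
  refine ⟨M, fun y hy => hsub fun N hN => ?_⟩
  have h1 := x.2 M N (hM N hN)
  have h2 := y.2 M N (hM N hN)
  rw [hy, h1] at h2
  rw [← h2]
  exact (hu N hN).2

theorem dense_closure_map_toProPCompletion {t : Set G}
    (ht : ∀ φ : ModPHom p G, (∀ g ∈ t, φ (Additive.ofMul g) = 0) → φ = 0) :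
    Dense (Subgroup.closure (toProPCompletion p G '' t) : Set (proPCompletion p G)) := by
  refine dense_iff_inter_open.2 fun U hU ⟨x, hx⟩ => ?_
  obtain ⟨M, hM⟩ := exists_subset_of_isOpen_proPCompletion hU hx
  obtain ⟨g, hg⟩ := QuotientGroup.mk_surjective (x.1 M)
  have htop := closure_sup_eq_top ht M.1.toSubgroup M.isPGroup
  obtain ⟨h, hh, m, hm, rfl⟩ := Subgroup.mem_sup_of_normal_right.1 (htop ▸ Subgroup.mem_top g)
  refine ⟨toProPCompletion p G h, hM _ ?_, ?_⟩
  · rw [← hg]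
    exact QuotientGroup.eq.2 (by simpa using hm)
  · rw [← MonoidHom.map_closure]
    exact Subgroup.mem_map_of_mem _ hh

-- The generators are images of elements of `G` whose evaluation functionals form a basis of the
-- span of all evaluations. A homomorphism vanishing on them vanishes on `G`, so the Burnside basis
-- theorem applies.
variable (p G) in
theorem exists_finset_dense_closure [Group.FG G] : ∃ s : Finset (proPCompletion p G),
    s.card ≤ Module.finrank (ZMod p) (ModPHom p G) ∧
      Dense (Subgroup.closure (s : Set (proPCompletion p G)) : Set (proPCompletion p G)) := by
  classical
  let v : G → Module.Dual (ZMod p) (ModPHom p G) := fun g =>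
    { toFun := fun φ => φ (Additive.ofMul g)
      map_add' := fun _ _ => rfl
      map_smul' := fun _ _ => rfl }
  obtain ⟨κ, a, -, hspan, hli⟩ := exists_linearIndependent' (ZMod p) v
  have : Finite κ := hli.finite
  have := Fintype.ofFinite κ
  have hcard := hli.fintype_card_le_finrank
  rw [Subspace.dual_finrank_eq] at hcard
  refine ⟨Finset.univ.image (toProPCompletion p G ∘ a),
    Finset.card_image_le.trans (by rwa [Finset.card_univ]), ?_⟩
  rw [Finset.coe_image, Finset.coe_univ, Set.image_comp]
  refine dense_closure_map_toProPCompletion fun φ hφ => AddMonoidHom.ext fun g => ?_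
  have hg : v g.toMul ∈ Submodule.span (ZMod p) (Set.range (v ∘ a)) :=
    hspan ▸ Submodule.subset_span ⟨_, rfl⟩
  have hle : Submodule.span (ZMod p) (Set.range (v ∘ a)) ≤
      LinearMap.ker (Module.Dual.eval (ZMod p) (ModPHom p G) φ) := by
    refine Submodule.span_le.2 ?_
    rintro _ ⟨k, rfl⟩
    exact hφ _ ⟨k, trivial, rfl⟩
  exact hle hg

variable (p G) in
/-- The common kernel of all homomorphisms to `𝔽_p`. -/
def modPKer : Subgroup G := ⨅ φ : ModPHom p G, φ.ker

instance : (modPKer p G).Normal :=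
  Subgroup.normal_iInf_normal fun _ => inferInstanceAs (MonoidHom.ker _).Normal

instance (φ : ModPHom p G) : φ.ker.FiniteIndex :=
  inferInstanceAs (MonoidHom.ker φ.toMultiplicativeRight).FiniteIndex

instance [Group.FG G] : (modPKer p G).FiniteIndex :=
  have : Finite (ModPHom p G) := Module.finite_of_finite (ZMod p)
  Subgroup.finiteIndex_iInf fun _ => inferInstance

theorem isPGroup_quotient_modPKer : IsPGroup p (G ⧸ modPKer p G) := by
  refine isPGroup_iff_pow_pow_eq_one.2 fun q => ⟨1, ?_⟩
  obtain ⟨g, rfl⟩ := QuotientGroup.mk_surjective q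
  rw [pow_one, ← QuotientGroup.mk_pow, QuotientGroup.eq_one_iff]
  refine Subgroup.mem_iInf.2 fun φ => ?_
  rw [ModPHom.mem_ker, ofMul_pow, map_nsmul, nsmul_eq_mul, CharP.cast_eq_zero, zero_mul]

/-- Every homomorphism to `𝔽_p` factors through the finite `p`-quotient by `modPKer` and so extends
to the completion with open fibres. Density makes it determined by its values on `s`. -/
theorem finrank_modPHom_le_card [Group.FG G] {s : Finset (proPCompletion p G)}
    (hs : Dense (Subgroup.closure (s : Set (proPCompletion p G)) : Set (proPCompletion p G))) :
    Module.finrank (ZMod p) (ModPHom p G) ≤ s.card := by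
  let N : PPowerIndexSubgroup p G := .of (modPKer p G) isPGroup_quotient_modPKer
  let ev : ModPHom p G → (proPCompletion p G →* Multiplicative (ZMod p)) := fun φ =>
    (QuotientGroup.lift (modPKer p G) φ.toMultiplicativeRight
      (iInf_le (fun φ : ModPHom p G => φ.ker) φ)).comp
      ((Pi.evalMonoidHom _ N).comp (proPCompletion p G).subtype)
  have ev_mk : ∀ φ (x : proPCompletion p G) (g : G), x.1 N = QuotientGroup.mk g →
      ev φ x = Multiplicative.ofAdd (φ (Additive.ofMul g)) := fun φ x g h =>
    (congrArg (QuotientGroup.lift (modPKer p G) φ.toMultiplicativeRight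
      (iInf_le (fun φ : ModPHom p G => φ.ker) φ)) h).trans (QuotientGroup.lift_mk _ _ _)
  let L : ModPHom p G →ₗ[ZMod p] (s → ZMod p) :=
    { toFun := fun φ x => (ev φ x.1).toAdd
      map_add' := fun φ ψ => funext fun x => by
        obtain ⟨g, hg⟩ := QuotientGroup.mk_surjective (x.1.1 N)
        simp only [Pi.add_apply]
        rw [ev_mk _ _ _ hg.symm, ev_mk _ _ _ hg.symm, ev_mk _ _ _ hg.symm]
        rfl
      map_smul' := fun c φ => funext fun x => by
        obtain ⟨g, hg⟩ := QuotientGroup.mk_surjective (x.1.1 N)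
        simp only [Pi.smul_apply]
        rw [ev_mk _ _ _ hg.symm, ev_mk _ _ _ hg.symm]
        rfl }
  have hL : Function.Injective L := by
    refine (injective_iff_map_eq_zero L).2 fun φ hφ => AddMonoidHom.ext fun g => ?_
    have hle : Subgroup.closure (s : Set (proPCompletion p G)) ≤ (ev φ).ker :=
      (Subgroup.closure_le _).2 fun x hx => congrFun hφ ⟨x, hx⟩
    have hopen := isOpen_proPCompletion_preimage N {QuotientGroup.mk g.toMul}
    obtain ⟨x, hx1, hx2⟩ := dense_iff_inter_open.1 hs _ hopen ⟨toProPCompletion p G g.toMul, rfl⟩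
    have h1 := hle hx2
    rw [MonoidHom.mem_ker, ev_mk φ x g.toMul hx1] at h1
    exact h1
  have h := LinearMap.finrank_le_finrank_of_injective hL
  rwa [Module.finrank_fintype_fun_eq_card, Fintype.card_coe] at h

variable (p G) in
/-- The minimal number of generators of the pro-`p` completion is the dimension of `H¹(G, 𝔽_p)`. -/
theorem proPRank_eq_finrank [Group.FG G] :
    proPRank p G = Module.finrank (ZMod p) (ModPHom p G) := by
  obtain ⟨s, hs, hd⟩ := exists_finset_dense_closure p G
  refine le_antisymm (le_trans (Nat.sInf_le ?_) hs) (le_csInf ⟨_, s, rfl, hd⟩ ?_)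
  · exact ⟨s, rfl, hd⟩
  · rintro _ ⟨s, rfl, hd⟩
    exact finrank_modPHom_le_card hd

end ProPRank

/-! ### Ranks of presented groups and the addition of deep relators. -/

section Rank

variable {p : ℕ} [Fact p.Prime] {X : Type*} [Fintype X]

instance [Finite X] (R : Set (FreeGroup X)) : Group.FG (PresentedGroup R) :=
  Group.fg_of_surjective (PresentedGroup.mk_surjective R)

theorem proPRank_presentedGroup_le_card (S : Set (FreeGroup X)) :
    proPRank p (PresentedGroup S) ≤ Fintype.card X := by
  rw [proPRank_eq_finrank, ← Module.finrank_fintype_fun_eq_card (ZMod p)]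
  let L : ModPHom p (PresentedGroup S) →ₗ[ZMod p] (X → ZMod p) :=
    { toFun := fun φ x => φ (Additive.ofMul (PresentedGroup.of x))
      map_add' := fun _ _ => rfl
      map_smul' := fun _ _ => rfl }
  refine LinearMap.finrank_le_finrank_of_injective (f := L) fun φ ψ h => ?_
  refine AddMonoidHom.toMultiplicativeRight.injective (PresentedGroup.ext fun x => ?_)
  exact congrFun h x

end Rank

section Relators

open NCPowerSeries

variable {p : ℕ} [Fact p.Prime] {X : Type*} [DecidableEq X] [Fintype X]

omit [Fintype X] in
theorem mem_dimensionSubgroup_one (f : FreeGroup X) : f ∈ dimensionSubgroup p X 1 := by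
  have h : Subgroup.closure (Set.range FreeGroup.of) ≤ dimensionSubgroup p X 1 := by
    refine (Subgroup.closure_le _).2 ?_
    rintro _ ⟨x, rfl⟩
    have : (magnus p (FreeGroup.of x) : NCPowerSeries X (ZMod p)) = 1 + var (ZMod p) x := by
      rw [magnus, FreeGroup.lift_apply_of]; rfl
    change (magnus p (FreeGroup.of x) : NCPowerSeries X (ZMod p)) - 1 ∈
      orderGE X (ZMod p) 1
    rw [this, add_sub_cancel_left]
    exact var_mem_orderGE _ x
  rw [FreeGroup.closure_range_of] at h
  exact h (Subgroup.mem_top f)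

omit [Fintype X] in
theorem magnus_nil (f : FreeGroup X) : (magnus p f : NCPowerSeries X (ZMod p)) [] = 1 := by
  have h := mem_dimensionSubgroup_one (p := p) f [] (by simp)
  rwa [NCPowerSeries.sub_apply, one_nil, sub_eq_zero] at h

/-- Magnus series have constant term 1, so their linear coefficients are additive; both sides are
homomorphisms agreeing on the generators. -/
theorem modPHom_apply_eq_sum (φ : ModPHom p (FreeGroup X)) (f : FreeGroup X) :
    φ (Additive.ofMul f) =
      ∑ x, (magnus p f : NCPowerSeries X (ZMod p)) [x] * φ (Additive.ofMul (FreeGroup.of x)) := by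
  let ψ : FreeGroup X →* Multiplicative (ZMod p) :=
    { toFun := fun f => Multiplicative.ofAdd (∑ x,
        (magnus p f : NCPowerSeries X (ZMod p)) [x] * φ (Additive.ofMul (FreeGroup.of x)))
      map_one' := by simp [one_cons]
      map_mul' := fun f g => by
        rw [← ofAdd_add, ← Finset.sum_add_distrib]
        refine congrArg _ (Finset.sum_congr rfl fun x _ => ?_)
        rw [map_mul, Units.val_mul, mul_cons, mul_nil, magnus_nil, magnus_nil, tail]
        ring }
  have h : φ.toMultiplicativeRight = ψ := by
    refine FreeGroup.ext_hom _ _ fun y => ?_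
    have : (magnus p (FreeGroup.of y) : NCPowerSeries X (ZMod p)) = 1 + var (ZMod p) y := by
      rw [magnus, FreeGroup.lift_apply_of]; rfl
    change Multiplicative.ofAdd _ = Multiplicative.ofAdd _
    rw [this, Finset.sum_eq_single y]
    · simp [NCPowerSeries.add_apply, one_cons, var]
    · intro x _ hx
      simp [NCPowerSeries.add_apply, one_cons, var, hx]
    · simp
  exact DFunLike.congr_fun h f

theorem modPHom_eq_zero_of_mem_dimensionSubgroup (φ : ModPHom p (FreeGroup X)) {f : FreeGroup X}
    (hf : f ∈ dimensionSubgroup p X 2) : φ (Additive.ofMul f) = 0 := by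
  rw [modPHom_apply_eq_sum]
  refine Finset.sum_eq_zero fun x _ => ?_
  have h := hf [x] (by simp)
  rw [NCPowerSeries.sub_apply, one_cons, sub_zero] at h
  rw [h, zero_mul]

/-- Adding relators from the second dimension subgroup does not lower the rank. -/
theorem proPRank_presentedGroup_le_union {S R : Set (FreeGroup X)}
    (hR : R ⊆ dimensionSubgroup p X 2) :
    proPRank p (PresentedGroup S) ≤ proPRank p (PresentedGroup (S ∪ R)) := by
  rw [proPRank_eq_finrank, proPRank_eq_finrank]
  have hS : ∀ f ∈ S, FreeGroup.lift (PresentedGroup.of (rels := S ∪ R)) f = 1 := fun f hf =>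
    (PresentedGroup.mk_eq_one_iff (rels := S ∪ R) (x := f)).2
      (Subgroup.subset_normalClosure (Or.inl hf)) ▸ by
        rw [show FreeGroup.lift (PresentedGroup.of (rels := S ∪ R)) =
          PresentedGroup.mk (S ∪ R) from FreeGroup.ext_hom _ _ fun x => FreeGroup.lift_apply_of]
  let π : PresentedGroup S →* PresentedGroup (S ∪ R) := PresentedGroup.toGroup hS
  let L : ModPHom p (PresentedGroup (S ∪ R)) →ₗ[ZMod p] ModPHom p (PresentedGroup S) :=
    { toFun := fun φ => φ.comp π.toAdditive
      map_add' := fun _ _ => rfl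
      map_smul' := fun _ _ => rfl }
  -- Every homomorphism on `⟨X | S⟩` kills `R`, because `R` has depth at least 2, and therefore
  -- descends to `⟨X | S ∪ R⟩`.
  refine LinearMap.finrank_le_finrank_of_surjective (f := L) fun φ => ?_
  let ψ : FreeGroup X →* Multiplicative (ZMod p) :=
    φ.toMultiplicativeRight.comp (PresentedGroup.mk S)
  have hψ : FreeGroup.lift (fun x => ψ (FreeGroup.of x)) = ψ :=
    FreeGroup.ext_hom _ _ fun x => FreeGroup.lift_apply_of
  have hker : ∀ f ∈ S ∪ R, FreeGroup.lift (fun x => ψ (FreeGroup.of x)) f = 1 := by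
    rw [hψ]
    rintro f (hf | hf)
    · change φ.toMultiplicativeRight (PresentedGroup.mk S f) = 1
      rw [PresentedGroup.one_of_mem hf, map_one]
    · exact modPHom_eq_zero_of_mem_dimensionSubgroup ψ.toAdditiveLeft (hR hf)
  refine ⟨(PresentedGroup.toGroup hker).toAdditiveLeft, ?_⟩
  refine AddMonoidHom.toMultiplicativeRight.injective (PresentedGroup.ext fun x => ?_)
  change PresentedGroup.toGroup hker (π (PresentedGroup.of x)) = ψ (FreeGroup.of x)
  rw [PresentedGroup.toGroup.of, PresentedGroup.toGroup.of]

/-- With rank at most 1 the expression would be at least `1 - t > 0`. -/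
theorem two_le_card_of_isGolodShafarevich {S : Set (FreeGroup X)} (hS : IsGolodShafarevich p S) :
    2 ≤ Fintype.card X := by
  obtain ⟨-, t, ht0, ht1, -, hlt⟩ := hS
  have hsum : 0 ≤ ∑' i : ℕ, ((relatorsOfDegree p S (i + 1)).ncard : ℝ) * t ^ (i + 1) :=
    tsum_nonneg fun i => by positivity
  refine le_trans ?_ (proPRank_presentedGroup_le_card (p := p) S)
  by_contra! h
  have h1 : (proPRank p (PresentedGroup S) : ℝ) ≤ 1 := by exact_mod_cast Nat.le_of_lt_succ h
  nlinarith

variable {r : ℕ → FreeGroup X} {N : ℕ} {R : Set (FreeGroup X)}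

omit [Fact (Nat.Prime p)] in
theorem relatorsOfDegree_subset_image (hr : ∀ e, r e ∈ dimensionSubgroup p X (N + e))
    (hR : R ⊆ Set.range r) (n : ℕ) :
    relatorsOfDegree p R n ⊆ r '' {e | N + e ≤ n} := by
  rintro f ⟨hf, -, hn⟩
  obtain ⟨e, rfl⟩ := hR hf
  refine ⟨e, ?_, rfl⟩
  by_contra h
  exact hn (zassenhaus_antitone p (show n + 1 ≤ N + e from Nat.lt_of_not_le h)
    (dimensionSubgroup_subset_zassenhaus p _ (hr e)))

omit [Fact (Nat.Prime p)] in
theorem relatorsOfDegree_finite (hr : ∀ e, r e ∈ dimensionSubgroup p X (N + e))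
    (hR : R ⊆ Set.range r) (n : ℕ) : (relatorsOfDegree p R n).Finite :=
  (((Set.finite_Iic n).subset fun _ (he : N + _ ≤ n) => (Nat.le_add_left _ _).trans he).image
    r).subset (relatorsOfDegree_subset_image hr hR n)

omit [Fact (Nat.Prime p)] in
theorem ncard_relatorsOfDegree_le (hr : ∀ e, r e ∈ dimensionSubgroup p X (N + e))
    (hR : R ⊆ Set.range r) (n : ℕ) : (relatorsOfDegree p R n).ncard ≤ n + 1 - N := by
  have hsub : {e | N + e ≤ n} ⊆ (Finset.range (n + 1 - N) : Set ℕ) := fun e (he : N + e ≤ n) => by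
    simp only [Finset.coe_range, Set.mem_Iio]
    omega
  have hfin : {e | N + e ≤ n}.Finite := (Finset.finite_toSet _).subset hsub
  calc (relatorsOfDegree p R n).ncard ≤ (r '' {e | N + e ≤ n}).ncard :=
        Set.ncard_le_ncard (relatorsOfDegree_subset_image hr hR n) (hfin.image r)
    _ ≤ {e | N + e ≤ n}.ncard := Set.ncard_image_le hfin
    _ ≤ (Finset.range (n + 1 - N) : Set ℕ).ncard := Set.ncard_le_ncard hsub
    _ = n + 1 - N := by rw [Set.ncard_coe_finset, Finset.card_range]

/-- A Golod-Shafarevich presentation stays so when sufficiently deep relators are added. -/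
theorem IsGolodShafarevich.exists_union {S : Set (FreeGroup X)} (hS : IsGolodShafarevich p S) :
    ∃ N₀, ∀ N ≥ N₀, ∀ r : ℕ → FreeGroup X, (∀ e, r e ∈ dimensionSubgroup p X (N + e)) →
      ∀ R ⊆ Set.range r, IsGolodShafarevich p (S ∪ R) := by
  obtain ⟨hfin, t, ht0, ht1, hsum, hlt⟩ := hS
  set a : ℕ → ℝ := fun i => ((relatorsOfDegree p S (i + 1)).ncard : ℝ) * t ^ (i + 1) with ha
  -- New relators of degree `i + 1` come from indices `e` with `N + e ≤ i + 1`, so there are at most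
  -- `i + 2 - N` of them.
  set c : ℕ → ℕ → ℝ := fun N i => ((i + 1 + 1 - N : ℕ) : ℝ) * t ^ (i + 1) with hc
  set b : ℕ → ℝ := fun i => ((i : ℝ) + 1) * t ^ i with hb
  have hbs : Summable b := by
    have h1 : Summable fun i : ℕ => (i : ℝ) * t ^ i := by
      simpa using summable_pow_mul_geometric_of_norm_lt_one 1
        (r := t) (by rwa [Real.norm_of_nonneg ht0.le])
    have h2 := summable_geometric_of_lt_one ht0.le ht1
    simpa only [hb, add_mul, one_mul] using h1.add h2
  have hcb : ∀ N i, 0 ≤ c N i := fun N i => by positivity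
  have hc0 : ∀ N i, c (N + 2) (i + N) ≤ b (i + N) := fun N i => by
    have h1 : ((i + N + 1 + 1 - (N + 2) : ℕ) : ℝ) ≤ ((i + N : ℕ) : ℝ) + 1 := by
      exact_mod_cast show i + N + 1 + 1 - (N + 2) ≤ i + N + 1 by omega
    have h2 : t ^ (i + N + 1) ≤ t ^ (i + N) := pow_le_pow_of_le_one ht0.le ht1.le (Nat.le_succ _)
    exact mul_le_mul h1 h2 (by positivity) (by positivity)
  have hc1 : ∀ N, ∀ i < N, c (N + 2) i = 0 := fun N i hi => by
    simp only [hc]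
    rw [show i + 1 + 1 - (N + 2) = 0 by omega]
    simp
  have hcs : ∀ N, Summable (c (N + 2)) := fun N =>
    (summable_nat_add_iff N).1 (Summable.of_nonneg_of_le (fun i => hcb _ _) (hc0 N)
      ((summable_nat_add_iff N).2 hbs))
  have hct : ∀ N, ∑' i, c (N + 2) i ≤ ∑' i, b (i + N) := fun N => by
    rw [← (hcs N).sum_add_tsum_nat_add N,
      Finset.sum_eq_zero fun i hi => hc1 N i (Finset.mem_range.1 hi), zero_add]
    exact ((summable_nat_add_iff N).2 (hcs N)).tsum_le_tsum (hc0 N)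
      ((summable_nat_add_iff N).2 hbs)
  -- Tails of the convergent series `b` eventually drop below the slack in the inequality for `S`.
  have hev := (tendsto_sum_nat_add b).eventually_lt_const
    (show (0 : ℝ) < -(1 - (proPRank p (PresentedGroup S) : ℝ) * t + ∑' i, a i) by linarith)
  obtain ⟨N₀, hN₀⟩ := Filter.eventually_atTop.1 hev
  -- The extra 2 puts all new relators into the second dimension subgroup, so the rank does not
  -- drop.
  refine ⟨N₀ + 2, fun N hN r hr R hR => ?_⟩
  obtain ⟨N, rfl⟩ := Nat.exists_eq_add_of_le' (show 2 ≤ N by omega)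
  have hle : ∀ i, ((relatorsOfDegree p (S ∪ R) (i + 1)).ncard : ℝ) * t ^ (i + 1) ≤
      a i + c (N + 2) i := fun i => by
    rw [relatorsOfDegree_union, ha, hc]
    simp only [← add_mul]
    refine mul_le_mul_of_nonneg_right ?_ (by positivity)
    exact_mod_cast (Set.ncard_union_le _ _).trans
      (Nat.add_le_add_left (ncard_relatorsOfDegree_le hr hR (i + 1)) _)
  have hs := Summable.of_nonneg_of_le (fun i => by positivity) hle (hsum.add (hcs N))
  refine ⟨fun i hi => ?_, t, ht0, ht1, hs, ?_⟩
  · rw [relatorsOfDegree_union]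
    exact (hfin i hi).union (relatorsOfDegree_finite hr hR i)
  · have h1 := hs.tsum_le_tsum hle (hsum.add (hcs N))
    rw [hsum.tsum_add (hcs N)] at h1
    have h2 := hct N
    have h3 := hN₀ N (by omega)
    have h4 : (proPRank p (PresentedGroup S) : ℝ) ≤ proPRank p (PresentedGroup (S ∪ R)) := by
      refine Nat.cast_le.2 (proPRank_presentedGroup_le_union fun f hf => ?_)
      obtain ⟨e, rfl⟩ := hR hf
      exact dimensionSubgroup_antitone p (by omega) (hr e)
    have h5 := mul_le_mul_of_nonneg_right h4 ht0.le
    linarith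

end Relators

/-! ### Dimension subgroups described by subword counts. -/

section Subwords

/-- The list of all subwords (subsequences) of a word, with multiplicities. -/
def subwords {X : Type*} (w : List X) : List (List X) :=
  w.foldr (fun x L => L ++ L.map (List.cons x)) [[]]

/-- The positive word obtained by replacing each inverse letter `x⁻¹` by `x ^ (q - 1)`. -/
def positiveWord {X : Type*} (q : ℕ) (w : List (X × Bool)) : List X :=
  w.flatMap fun a => if a.2 then [a.1] else List.replicate (q - 1) a.1

/-- The condition on a word which describes membership in the `n`-th dimension subgroup by counting
subwords. -/
def HasDepth {X : Type*} [DecidableEq X] (p n : ℕ) (w : List (X × Bool)) : Prop :=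
  -- Words outside this list have count zero, so the quantifier can be bounded by a finite list,
  -- which keeps the predicate primitive recursive.
  ∀ v ∈ subwords (positiveWord (p ^ n) w), ¬v.length < n ∨ v = [] ∨
    (subwords (positiveWord (p ^ n) w)).count v % p = 0

namespace NCPowerSeries

variable {X : Type*} [DecidableEq X]

section

variable {R : Type*} [Ring R]

/-- The coefficients of a product of the series `1 + u_x` count subwords. -/
theorem prod_one_add_var_apply (w v : List X) :
    (w.map fun x => (1 + var R x : NCPowerSeries X R)).prod v = ((subwords w).count v : R) := by
  induction w generalizing v with
  | nil =>
    cases v with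
    | nil => simp [subwords, one_nil]
    | cons a v => simp [subwords, one_cons]
  | cons x w ih =>
    have h : subwords (x :: w) = subwords w ++ (subwords w).map (List.cons x) := rfl
    rw [List.map_cons, List.prod_cons, add_mul, one_mul, add_apply, ih, h, List.count_append,
      Nat.cast_add]
    congr 1
    cases v with
    | nil =>
      rw [var_mul_nil, List.count_eq_zero_of_not_mem (by simp), Nat.cast_zero]
    | cons a v =>
      rw [var_mul_cons]
      split_ifs with hax
      · rw [hax, List.count_map_of_injective _ _ List.cons_injective, ih]
      · rw [List.count_eq_zero_of_not_mem, Nat.cast_zero]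
        simp only [List.mem_map, List.cons.injEq, not_exists, not_and]
        exact fun _ _ h => absurd h.symm hax

theorem var_pow_mem_orderGE (x : X) (n : ℕ) : var R x ^ n ∈ orderGE X R n := by
  induction n with
  | zero => exact mem_orderGE_zero _
  | succ n ih => exact pow_succ (var R x) n ▸ mul_mem_orderGE ih (var_mem_orderGE R x)

omit [DecidableEq X] in
theorem mul_sub_mul_mem_orderGE {n : ℕ} {f g f' g' : NCPowerSeries X R}
    (h : f - g ∈ orderGE X R n) (h' : f' - g' ∈ orderGE X R n) :
    f * f' - g * g' ∈ orderGE X R n := by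
  have : f * f' - g * g' = (f - g) * f' + g * (f' - g') := by noncomm_ring
  rw [this]
  exact add_mem (mul_mem_orderGE_right h _) (mul_mem_orderGE_left _ h')

omit [DecidableEq X] in
theorem natCast_apply (n : ℕ) (w : List X) :
    (n : NCPowerSeries X R) w = n * (1 : NCPowerSeries X R) w := by
  induction n with
  | zero => simp [zero_apply]
  | succ n ih => rw [Nat.cast_succ, add_apply, ih, Nat.cast_succ, add_mul, one_mul]

end

variable {p : ℕ} [Fact p.Prime]

instance : Nontrivial (NCPowerSeries X (ZMod p)) :=
  ⟨1, 0, fun h => one_ne_zero (α := ZMod p) (by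
    simpa only [one_nil, zero_apply] using congrFun h [])⟩

instance : CharP (NCPowerSeries X (ZMod p)) p :=
  (CharP.charP_iff_prime_eq_zero Fact.out).2 (ext fun w => by
    rw [natCast_apply, CharP.cast_eq_zero, zero_mul, zero_apply])

/-- In characteristic `p` one has `(1 + u_x) ^ (p ^ n) = 1 + u_x ^ (p ^ n)`, and `n < p ^ n`. Hence
`x⁻¹` may be replaced by `x ^ (p ^ n - 1)` up to order `n`. -/
theorem altGeom_sub_pow_mem_orderGE (x : X) (n : ℕ) :
    altGeom (ZMod p) x - (1 + var (ZMod p) x) ^ (p ^ n - 1) ∈ orderGE X (ZMod p) n := by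
  have hpos : 0 < p ^ n := pow_pos (Fact.out : p.Prime).pos n
  have h1 : altGeom (ZMod p) x * (1 + var (ZMod p) x) ^ (p ^ n) =
      (1 + var (ZMod p) x) ^ (p ^ n - 1) := by
    rw [← Nat.sub_add_cancel hpos, pow_succ', ← mul_assoc, altGeom_mul_one_add_var, one_mul,
      Nat.add_sub_cancel]
  have h2 : (1 + var (ZMod p) x) ^ (p ^ n) = 1 + var (ZMod p) x ^ (p ^ n) := by
    rw [add_pow_char_pow_of_commute _ _ (Commute.one_left _), one_pow]
  rw [← h1, h2, mul_add, mul_one, sub_add_cancel_left]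
  exact neg_mem (mul_mem_orderGE_left _ (orderGE_antitone
    (Nat.lt_pow_self (Fact.out : p.Prime).one_lt).le (var_pow_mem_orderGE x _)))

theorem magnus_mk_sub_mem_orderGE (n : ℕ) (w : List (X × Bool)) :
    (magnus p (FreeGroup.mk w) : NCPowerSeries X (ZMod p)) -
      ((positiveWord (p ^ n) w).map fun x => (1 + var (ZMod p) x : NCPowerSeries X (ZMod p))).prod ∈
        orderGE X (ZMod p) n := by
  induction w with
  | nil =>
    rw [← FreeGroup.one_eq_mk, map_one]
    simp [positiveWord, zero_mem]
  | cons a w ih =>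
    have h : positiveWord (p ^ n) (a :: w) =
      (if a.2 then [a.1] else List.replicate (p ^ n - 1) a.1) ++ positiveWord (p ^ n) w := rfl
    have h' : FreeGroup.mk (a :: w) = FreeGroup.mk [a] * FreeGroup.mk w := rfl
    rw [h, h', map_mul, Units.val_mul, List.map_append, List.prod_append]
    refine mul_sub_mul_mem_orderGE ?_ ih
    rw [magnus, FreeGroup.lift_mk]
    obtain ⟨x, _ | _⟩ := a
    · have h1 : (((oneAddVar (ZMod p) x)⁻¹ : (NCPowerSeries X (ZMod p))ˣ) :
          NCPowerSeries X (ZMod p)) = altGeom (ZMod p) x := rfl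
      simpa [h1] using altGeom_sub_pow_mem_orderGE x n
    · simp only [List.map_cons, List.map_nil, List.prod_cons, List.prod_nil, cond_true, mul_one,
        if_true]
      change (1 + var (ZMod p) x) - (1 + var (ZMod p) x) ∈ _
      rw [sub_self]
      exact zero_mem _

theorem count_nil_subwords (w : List X) : (subwords w).count [] = 1 := by
  induction w with
  | nil => rfl
  | cons x w ih =>
    have h : subwords (x :: w) = subwords w ++ (subwords w).map (List.cons x) := rfl
    rw [h, List.count_append, ih, List.count_eq_zero_of_not_mem (by simp)]

theorem mk_mem_dimensionSubgroup_iff (n : ℕ) (w : List (X × Bool)) :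
    FreeGroup.mk w ∈ dimensionSubgroup p X n ↔ HasDepth p n w := by
  have key : FreeGroup.mk w ∈ dimensionSubgroup p X n ↔ ∀ v : List X, v.length < n →
      ((subwords (positiveWord (p ^ n) w)).count v : ZMod p) =
        (1 : NCPowerSeries X (ZMod p)) v := by
    refine forall_congr' fun v => imp_congr_right fun hv => ?_
    have h := magnus_mk_sub_mem_orderGE (p := p) n w v hv
    rw [sub_apply, prod_one_add_var_apply, sub_eq_zero] at h
    rw [sub_apply, h, sub_eq_zero]
  rw [key]
  constructor
  · intro h v _
    rcases lt_or_ge v.length n with hv | hv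
    · cases v with
      | nil => exact Or.inr (Or.inl rfl)
      | cons a v =>
        refine Or.inr (Or.inr (Nat.mod_eq_zero_of_dvd ?_))
        rw [← ZMod.natCast_eq_zero_iff, h _ hv, one_cons]
    · exact Or.inl (not_lt.2 hv)
  · intro h v hv
    cases v with
    | nil => rw [count_nil_subwords, one_nil, Nat.cast_one]
    | cons a v =>
      rw [one_cons]
      by_cases hm : a :: v ∈ subwords (positiveWord (p ^ n) w)
      · rw [ZMod.natCast_eq_zero_iff]
        exact Nat.dvd_of_mod_eq_zero
          (((h _ hm).resolve_left (not_not.2 hv)).resolve_left (List.cons_ne_nil _ _))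
      · rw [List.count_eq_zero_of_not_mem hm, Nat.cast_zero]

end NCPowerSeries

end Subwords

/-! ### Primitive recursiveness of the free group operations, and enumerability. -/

section Computability

variable {X : Type*} [Primcodable X] [DecidableEq X]

theorem Primrec.nat_pow : Primrec₂ ((· ^ ·) : ℕ → ℕ → ℕ) :=
  Primrec₂.unpaired'.1 Nat.Primrec.pow

omit [DecidableEq X] in
theorem Primrec.list_replicate : Primrec₂ (List.replicate : ℕ → X → List X) :=
  (Primrec.list_map (Primrec.list_range.comp Primrec.fst)
    (Primrec.snd.comp Primrec.fst).to₂).of_eq fun a => by simp [List.map_const']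

omit [DecidableEq X] in
theorem primrec_subwords : Primrec (subwords : List X → List (List X)) :=
  Primrec.list_foldr Primrec.id (Primrec.const [[]])
    (Primrec.list_append.comp (Primrec.snd.comp Primrec.snd)
      (Primrec.list_map (Primrec.snd.comp Primrec.snd)
        (Primrec.list_cons.comp (Primrec.fst.comp (Primrec.snd.comp Primrec.fst))
          Primrec.snd).to₂)).to₂

omit [DecidableEq X] in
theorem primrec_positiveWord : Primrec₂ (positiveWord : ℕ → List (X × Bool) → List X) :=
  Primrec.list_flatMap Primrec.snd
    (Primrec.ite (Primrec.eq.comp (Primrec.snd.comp Primrec.snd) (Primrec.const true))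
      (Primrec.list_cons.comp (Primrec.fst.comp Primrec.snd) (Primrec.const []))
      (Primrec.list_replicate.comp
        (Primrec.nat_sub.comp (Primrec.fst.comp Primrec.fst) (Primrec.const 1))
        (Primrec.fst.comp Primrec.snd))).to₂

theorem Primrec.list_count [BEq X] [LawfulBEq X] : Primrec₂ (List.count : X → List X → ℕ) := by
  classical
  exact (Primrec.list_length.comp
    ((Primrec.eq (α := X)).listFilter.comp Primrec.snd Primrec.fst)).of_eq fun a => by
      rw [List.count_eq_length_filter]
      refine congrArg List.length (List.filter_congr fun x _ => ?_)
      rw [Bool.eq_iff_iff]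
      simp

theorem primrecRel_hasDepth (p : ℕ) : PrimrecRel (HasDepth (X := X) p) := by
  have hR : PrimrecRel fun (v : List X) (b : List (List X) × ℕ) =>
      ¬v.length < b.2 ∨ v = [] ∨ b.1.count v % p = 0 :=
    (Primrec.nat_lt.comp (Primrec.list_length.comp Primrec.fst)
      (Primrec.snd.comp Primrec.snd)).not.or
    ((Primrec.eq.comp Primrec.fst (Primrec.const [])).or
      (Primrec.eq.comp (Primrec.nat_mod.comp
        (Primrec.list_count.comp Primrec.fst (Primrec.fst.comp Primrec.snd))
        (Primrec.const p)) (Primrec.const 0)))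
  have hL : Primrec fun a : ℕ × List (X × Bool) => subwords (positiveWord (p ^ a.1) a.2) :=
    primrec_subwords.comp (primrec_positiveWord.comp
      (Primrec.nat_pow.comp (Primrec.const p) Primrec.fst) Primrec.snd)
  exact hR.forall_mem_list.comp hL (hL.pair Primrec.fst)

theorem primrec_reduce : Primrec (FreeGroup.reduce : List (X × Bool) → List (X × Bool)) := by
  have h1 : Primrec₂ fun (b : List (X × Bool) × (X × Bool) × List (X × Bool))
      (c : (X × Bool) × List (X × Bool)) =>
      if b.2.1.1 = c.1.1 ∧ b.2.1.2 = not c.1.2 then c.2 else b.2.1 :: c.1 :: c.2 := by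
    have hb := (Primrec.fst (α := X × Bool) (β := List (X × Bool))).comp
      ((Primrec.snd (α := List (X × Bool))).comp
        (Primrec.fst (β := (X × Bool) × List (X × Bool))))
    have hc := (Primrec.fst (α := X × Bool) (β := List (X × Bool))).comp
      (Primrec.snd (α := List (X × Bool) × (X × Bool) × List (X × Bool)))
    have hc' := (Primrec.snd (α := X × Bool) (β := List (X × Bool))).comp
      (Primrec.snd (α := List (X × Bool) × (X × Bool) × List (X × Bool)))
    exact Primrec.ite
      ((Primrec.eq.comp (Primrec.fst.comp hb) (Primrec.fst.comp hc)).and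
        (Primrec.eq.comp (Primrec.snd.comp hb) (Primrec.not.comp (Primrec.snd.comp hc))))
      hc' (Primrec.list_cons.comp hb (Primrec.list_cons.comp hc hc'))
  have h2 := Primrec.list_casesOn (Primrec.snd.comp Primrec.snd)
    (Primrec.list_cons.comp (Primrec.fst.comp Primrec.snd) (Primrec.const [])) h1
  refine (Primrec.list_foldr Primrec.id (Primrec.const []) h2.to₂).of_eq fun L => ?_
  induction L with
  | nil => rfl
  | cons a L ih =>
    rw [FreeGroup.reduce.cons, ← ih]
    rfl

omit [Primcodable X] in
theorem mk_eq_mk_iff_reduce_eq {a b : List (X × Bool)} :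
    FreeGroup.mk a = FreeGroup.mk b ↔ FreeGroup.reduce a = FreeGroup.reduce b :=
  ⟨FreeGroup.reduce.sound, FreeGroup.reduce.exact⟩

theorem primrecRel_mk_eq_mk :
    PrimrecRel fun a b : List (X × Bool) => FreeGroup.mk a = FreeGroup.mk b :=
  (Primrec.eq.comp (primrec_reduce.comp Primrec.fst) (primrec_reduce.comp Primrec.snd)).of_eq
    fun _ => mk_eq_mk_iff_reduce_eq.symm

omit [DecidableEq X] in
theorem primrec_invRev : Primrec (FreeGroup.invRev : List (X × Bool) → List (X × Bool)) :=
  Primrec.list_reverse.comp (Primrec.list_map Primrec.id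
    ((Primrec.fst.comp Primrec.snd).pair (Primrec.not.comp (Primrec.snd.comp Primrec.snd))).to₂)

omit [Primcodable X] [DecidableEq X] in
theorem mk_mul_inv_mk (a b : List (X × Bool)) :
    FreeGroup.mk a * (FreeGroup.mk b)⁻¹ = FreeGroup.mk (a ++ FreeGroup.invRev b) := by
  rw [FreeGroup.inv_mk, FreeGroup.mul_mk]

/-- A number decodes to at most one `t`, so the existential is a single test rather than a search.
-/
theorem PrimrecPred.exists_decode {α T : Type*} [Primcodable α] [Primcodable T]
    {Q : α × T → Prop} (hQ : PrimrecPred Q) :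
    PrimrecPred fun a : α × ℕ => ∃ t ∈ (Encodable.decode a.2 : Option T), Q (a.1, t) := by
  classical
  have h : Primrec fun a : α × ℕ =>
      (((Encodable.decode a.2 : Option T).map fun t => decide (Q (a.1, t))).getD false) :=
    Primrec.option_getD.comp (Primrec.option_map (Primrec.decode.comp Primrec.snd)
      (hQ.decide.comp ((Primrec.fst.comp Primrec.fst).pair Primrec.snd)).to₂) (Primrec.const false)
  refine (Primrec.eq.comp h (Primrec.const true)).of_eq fun a => ?_
  cases (Encodable.decode a.2 : Option T) <;> simp

/-- The projection of a primitive recursive predicate is recursively enumerable. -/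
theorem PrimrecPred.rePred_exists {α T : Type*} [Primcodable α] [Primcodable T]
    {Q : α × T → Prop} (hQ : PrimrecPred Q) : REPred fun a => ∃ t, Q (a, t) := by
  classical
  have h0 : Partrec₂ fun (a : α) (n : ℕ) =>
      Part.some (decide (∃ t ∈ (Encodable.decode n : Option T), Q (a, t))) :=
    hQ.exists_decode.decide.to_comp.partrec
  have h := (Partrec.rfind h0).dom_re
  refine h.of_eq fun a => ?_
  refine Nat.rfind_dom.trans ?_
  constructor
  · rintro ⟨n, hn, -⟩
    obtain ⟨t, -, ht⟩ := of_decide_eq_true (Part.mem_some_iff.1 hn).symm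
    exact ⟨t, ht⟩
  · rintro ⟨t, ht⟩
    exact ⟨Encodable.encode t, Part.mem_some_iff.2
      (decide_eq_true ⟨t, Encodable.encodek t, ht⟩).symm, fun _ => trivial⟩

open Nat.Partrec in
/-- Every recursively enumerable predicate is the domain of some code. -/
theorem REPred.exists_code {α : Type*} [Primcodable α] {q : α → Prop} (hq : REPred q) :
    ∃ c : Code, ∀ a, q a ↔ ∃ s, (Code.evaln s c (Encodable.encode a)).isSome := by
  obtain ⟨c, hc⟩ := Code.exists_code.1 hq
  refine ⟨c, fun a => ?_⟩
  have h : q a ↔ (Code.eval c (Encodable.encode a)).Dom := by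
    rw [hc]
    simp [Encodable.encodek, Part.assert]
  rw [h, Part.dom_iff_mem]
  simp only [Code.evaln_complete, Option.isSome_iff_exists, Option.mem_def]
  exact exists_comm

end Computability

/-! ### The simple set of relations and the theorem. -/

section SimpleSet

open Nat.Partrec

variable {d : ℕ}

/-- `((a, b), s)` witnesses that the words `a`, `b` are enumerated by the `e`-th code within `s`
steps, and that they represent distinct elements congruent modulo the dimension subgroup of index
`N + e`. -/
def IsCandidate (p N e : ℕ) (t : (List (Fin d × Bool) × List (Fin d × Bool)) × ℕ) : Prop :=
  ((Code.evaln t.2 (Denumerable.ofNat Code e) (Encodable.encode t.1.1)).isSome ∧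
    (Code.evaln t.2 (Denumerable.ofNat Code e) (Encodable.encode t.1.2)).isSome) ∧
  FreeGroup.mk t.1.1 ≠ FreeGroup.mk t.1.2 ∧
  HasDepth p (N + e) (t.1.1 ++ FreeGroup.invRev t.1.2)

theorem primrec_isCandidate (p N : ℕ) : PrimrecPred
    fun a : ℕ × (List (Fin d × Bool) × List (Fin d × Bool)) × ℕ => IsCandidate p N a.1 a.2 := by
  have he : Primrec fun a : ℕ × (List (Fin d × Bool) × List (Fin d × Bool)) × ℕ => a.1 := Primrec.fst
  have ha : Primrec fun a : ℕ × (List (Fin d × Bool) × List (Fin d × Bool)) × ℕ => a.2.1.1 :=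
    Primrec.fst.comp (Primrec.fst.comp Primrec.snd)
  have hb : Primrec fun a : ℕ × (List (Fin d × Bool) × List (Fin d × Bool)) × ℕ => a.2.1.2 :=
    Primrec.snd.comp (Primrec.fst.comp Primrec.snd)
  have hs : Primrec fun a : ℕ × (List (Fin d × Bool) × List (Fin d × Bool)) × ℕ => a.2.2 :=
    Primrec.snd.comp Primrec.snd
  have hev : ∀ {f : ℕ × (List (Fin d × Bool) × List (Fin d × Bool)) × ℕ → List (Fin d × Bool)},
      Primrec f → PrimrecPred fun a : ℕ × (List (Fin d × Bool) × List (Fin d × Bool)) × ℕ =>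
        (Code.evaln a.2.2 (Denumerable.ofNat Code a.1) (Encodable.encode (f a))).isSome = true :=
    fun hf => Primrec.eq.comp (Primrec.option_isSome.comp (Code.primrec_evaln.comp
      ((hs.pair ((Primrec.ofNat Code).comp he)).pair (Primrec.encode.comp hf)))) (Primrec.const true)
  exact ((hev ha).and (hev hb)).and ((primrecRel_mk_eq_mk.comp ha hb).not.and
    ((primrecRel_hasDepth p).comp (Primrec.nat_add.comp (Primrec.const N) he)
      (Primrec.list_append.comp ha (primrec_invRev.comp hb))))

/-- The natural number `k` codes a candidate for the index `e`. -/
def CodesCandidate (d p N e k : ℕ) : Prop :=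
  ∃ t ∈ (Encodable.decode k : Option ((List (Fin d × Bool) × List (Fin d × Bool)) × ℕ)),
    IsCandidate p N e t

/-- The natural number `k` codes `t`, which is the first candidate for the index `e`. -/
def IsFirstCandidate (p N e k : ℕ) (t : (List (Fin d × Bool) × List (Fin d × Bool)) × ℕ) : Prop :=
  (t ∈ (Encodable.decode k : Option ((List (Fin d × Bool) × List (Fin d × Bool)) × ℕ)) ∧
    IsCandidate p N e t) ∧ ∀ j < k, ¬CodesCandidate d p N e j

theorem IsFirstCandidate.unique {p N e k l : ℕ}
    {t u : (List (Fin d × Bool) × List (Fin d × Bool)) × ℕ} (ht : IsFirstCandidate p N e k t)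
    (hu : IsFirstCandidate p N e l u) : t = u := by
  have hkl : k = l := le_antisymm (not_lt.1 fun h => ht.2 l h ⟨u, hu.1⟩)
    (not_lt.1 fun h => hu.2 k h ⟨t, ht.1⟩)
  subst hkl
  exact Option.mem_unique ht.1.1 hu.1.1

theorem exists_isFirstCandidate {p N e : ℕ}
    {t : (List (Fin d × Bool) × List (Fin d × Bool)) × ℕ} (ht : IsCandidate p N e t) :
    ∃ k u, IsFirstCandidate (d := d) p N e k u := by
  classical
  have h : ∃ k, CodesCandidate d p N e k := ⟨Encodable.encode t, t, Encodable.encodek t, ht⟩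
  obtain ⟨u, hu⟩ := Nat.find_spec h
  exact ⟨Nat.find h, u, hu, fun j hj => Nat.find_min h hj⟩

/-- The relator `a * b⁻¹` defined by a pair of words. -/
def pairRelator (t : (List (Fin d × Bool) × List (Fin d × Bool)) × ℕ) : FreeGroup (Fin d) :=
  FreeGroup.mk t.1.1 * (FreeGroup.mk t.1.2)⁻¹

/-- The set of relators which identifies, for each computably enumerable set, the first two of its
elements found to be congruent modulo a deep dimension subgroup. -/
def simpleRelators (d p N : ℕ) : Set (FreeGroup (Fin d)) :=
  {f | ∃ e k t, IsFirstCandidate p N e k t ∧ f = pairRelator t}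

theorem isCESet_simpleRelators (d p N : ℕ) : IsCESet (simpleRelators d p N) := by
  let T := (List (Fin d × Bool) × List (Fin d × Bool)) × ℕ
  have hcode' : PrimrecPred fun a : ℕ × ℕ => CodesCandidate d p N a.1 a.2 :=
    (primrec_isCandidate p N).exists_decode
  have hcode : PrimrecRel fun k e => CodesCandidate d p N e k :=
    PrimrecPred.comp (f := fun a : ℕ × ℕ => (a.2, a.1)) hcode' (Primrec.snd.pair Primrec.fst)
  have hw : Primrec fun a : List (Fin d × Bool) × (ℕ × ℕ) × T => a.1 := Primrec.fst
  have he : Primrec fun a : List (Fin d × Bool) × (ℕ × ℕ) × T => a.2.1.1 :=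
    Primrec.fst.comp (Primrec.fst.comp Primrec.snd)
  have hk : Primrec fun a : List (Fin d × Bool) × (ℕ × ℕ) × T => a.2.1.2 :=
    Primrec.snd.comp (Primrec.fst.comp Primrec.snd)
  have ht : Primrec fun a : List (Fin d × Bool) × (ℕ × ℕ) × T => a.2.2 :=
    Primrec.snd.comp Primrec.snd
  have h1 : PrimrecPred fun a : List (Fin d × Bool) × (ℕ × ℕ) × T =>
      (Encodable.decode a.2.1.2 : Option T) = some a.2.2 :=
    Primrec.eq.comp (Primrec.decode.comp hk) (Primrec.option_some.comp ht)
  have h2 : PrimrecPred fun a : List (Fin d × Bool) × (ℕ × ℕ) × T =>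
      IsCandidate p N a.2.1.1 a.2.2 := (primrec_isCandidate p N).comp (he.pair ht)
  -- Minimality of the code `k` is a bounded quantification, hence still primitive recursive; this
  -- is where decidability of `HasDepth`, not just its enumerability, matters.
  have h3 : PrimrecPred fun a : List (Fin d × Bool) × (ℕ × ℕ) × T =>
      ∀ j < a.2.1.2, ¬CodesCandidate d p N a.2.1.1 j := hcode.not.forall_lt.comp hk he
  have h4 : PrimrecPred fun a : List (Fin d × Bool) × (ℕ × ℕ) × T =>
      FreeGroup.mk a.1 = FreeGroup.mk (a.2.2.1.1 ++ FreeGroup.invRev a.2.2.1.2) :=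
    primrecRel_mk_eq_mk.comp hw (Primrec.list_append.comp
      (Primrec.fst.comp (Primrec.fst.comp ht))
      (primrec_invRev.comp (Primrec.snd.comp (Primrec.fst.comp ht))))
  have hQ : PrimrecPred fun a : List (Fin d × Bool) × (ℕ × ℕ) × T =>
      IsFirstCandidate p N a.2.1.1 a.2.1.2 a.2.2 ∧ FreeGroup.mk a.1 = pairRelator a.2.2 :=
    (((h1.and h2).and h3).and h4).of_eq fun a =>
      and_congr Iff.rfl (by rw [pairRelator, mk_mul_inv_mk])
  refine hQ.rePred_exists.of_eq fun w => ?_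
  constructor
  · rintro ⟨⟨⟨e, k⟩, t⟩, h1, h2⟩
    exact ⟨e, k, t, h1, h2⟩
  · rintro ⟨e, k, t, h1, h2⟩
    exact ⟨⟨⟨e, k⟩, t⟩, h1, h2⟩

variable {p : ℕ} [Fact p.Prime]

theorem pairRelator_mem_dimensionSubgroup {N e : ℕ}
    {t : (List (Fin d × Bool) × List (Fin d × Bool)) × ℕ} (ht : IsCandidate p N e t) :
    pairRelator t ∈ dimensionSubgroup p (Fin d) (N + e) := by
  rw [pairRelator, mk_mul_inv_mk]
  exact (NCPowerSeries.mk_mem_dimensionSubgroup_iff _ _).2 ht.2.2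

/-- First candidates are unique, so each `e` yields at most one relator; the value 1 fills the
indices without one. The sequence `r` need not be computable, as it serves only to count relators.
-/
theorem exists_simpleRelators_subset_range (d N : ℕ) : ∃ r : ℕ → FreeGroup (Fin d),
    (∀ e, r e ∈ dimensionSubgroup p (Fin d) (N + e)) ∧ simpleRelators d p N ⊆ Set.range r := by
  have h : ∀ e, ∃ f ∈ dimensionSubgroup p (Fin d) (N + e), ∀ k t,
      IsFirstCandidate (d := d) p N e k t → f = pairRelator t := fun e => by
    by_cases hc : ∃ k t, IsFirstCandidate (d := d) p N e k t
    · obtain ⟨k, t, ht⟩ := hc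
      exact ⟨_, pairRelator_mem_dimensionSubgroup ht.1.2, fun l u hu => by rw [ht.unique hu]⟩
    · exact ⟨1, one_mem _, fun k t ht => absurd ⟨k, t, ht⟩ hc⟩
  choose r hr hr' using h
  refine ⟨r, hr, ?_⟩
  rintro _ ⟨e, k, t, ht, rfl⟩
  exact ⟨e, hr' e k t ht⟩

theorem simpleRelators_meets (N : ℕ) {B : Set (FreeGroup (Fin d))} (hB : B.Infinite)
    (hce : IsCESet B) : ∃ u ∈ B, ∃ v ∈ B, u ≠ v ∧ u * v⁻¹ ∈ simpleRelators d p N := by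
  obtain ⟨c, hc⟩ := hce.exists_code
  obtain ⟨e, rfl⟩ : ∃ e, c = Denumerable.ofNat Code e :=
    ⟨Encodable.encode c, (Denumerable.ofNat_encode c).symm⟩
  have : NeZero p := ⟨(Fact.out : p.Prime).ne_zero⟩
  obtain ⟨u, hu, v, hv, huv, hd⟩ := exists_ne_mul_inv_mem_dimensionSubgroup p (N + e) hB
  obtain ⟨a, rfl⟩ := Quot.exists_rep u
  obtain ⟨b, rfl⟩ := Quot.exists_rep v
  obtain ⟨s, hs⟩ := (hc a).1 hu
  obtain ⟨s', hs'⟩ := (hc b).1 hv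
  have hmono : ∀ {m n : ℕ} {x : ℕ}, m ≤ n →
      (Code.evaln m (Denumerable.ofNat Code e) x).isSome →
        (Code.evaln n (Denumerable.ofNat Code e) x).isSome := fun hmn h => by
    obtain ⟨y, hy⟩ := Option.isSome_iff_exists.1 h
    exact Option.isSome_iff_exists.2 ⟨y, Code.evaln_mono hmn hy⟩
  have hcand : IsCandidate p N e ((a, b), max s s') :=
    ⟨⟨hmono (le_max_left _ _) hs, hmono (le_max_right _ _) hs'⟩, huv,
      (NCPowerSeries.mk_mem_dimensionSubgroup_iff _ _).1 (by rw [← mk_mul_inv_mk]; exact hd)⟩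
  obtain ⟨k, t, ht⟩ := exists_isFirstCandidate hcand
  -- The first candidate may differ from the pair given by the pigeonhole principle, but its two
  -- words are also enumerated, so they represent elements of `B`.
  exact ⟨_, (hc t.1.1).2 ⟨_, ht.1.2.1.1⟩, _, (hc t.1.2).2 ⟨_, ht.1.2.1.2⟩, ht.1.2.2.1,
    e, k, t, ht, rfl⟩

end SimpleSet

theorem mainTheorem2 (p : ℕ) (hp : p.Prime) (d : ℕ) (S : Set (FreeGroup (Fin d)))
    (hS : IsGolodShafarevich p S) :
    ∃ R : Set (FreeGroup (Fin d)), IsSimpleSetOfRelations R ∧ IsGolodShafarevich p (S ∪ R) := by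
  have : Fact p.Prime := ⟨hp⟩
  obtain ⟨N₀, hN₀⟩ := hS.exists_union
  -- `N₀` preserves the Golod–Shafarevich condition for `S ∪ R`, and 6 is the depth required for `⟨X
  -- | R⟩` to be infinite.
  obtain ⟨r, hr, hR⟩ := exists_simpleRelators_subset_range (p := p) d (max N₀ 6)
  refine ⟨simpleRelators d p (max N₀ 6), ⟨isCESet_simpleRelators d p _, ?_, fun B hB hce =>
    simpleRelators_meets _ hB hce⟩, hN₀ _ (le_max_left _ _) r hr _ hR⟩
  exact infinite_presentedGroup_of_mem_dimensionSubgroup r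
    (two_le_card_of_isGolodShafarevich hS) (le_max_right _ _) hr hR
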